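/- Let $\gamma>1$ and let $U=(u_1,u_2)$ be a domain wall, that is, a real $C^2$ solution of $$-u_1''+(u_1^2+\gamma u_2^2-1)u_1=0,\qquad -u_2''+(\gamma u_1^2+u_2^2-1)u_2=0\quad\text{on }\mathbb R$$ with $(u_1,u_2)\to(0,1)$ as $x\to-\infty$ and $(u_1,u_2)\to(1,0)$ as $x\to+\infty$. Let $\mathcal H$ be the space of all $\Psi=(\psi_1,\psi_2)\in H^1_{loc}(\mathbb R;\mathbb C^2)$ with $\|\Psi\|_{\mathcal H}^2=\langle\Psi,\Psi\rangle_{\mathcal H}<\infty$, where $$\langle\Psi,\Phi\rangle_{\mathcal H}=\sum_{j=1}^2\int_{\mathbb R}\Big[\psi_j'\,\overline{\varphi_j'}+(\gamma-1)(1-u_j^2)\,\psi_j\,\overline{\varphi_j}\Big]dx ,$$ and set $\|\Psi\|_{\mathcal H}=\infty$ for $\Psi\in H^1_{loc}$ not in $\mathcal H$. Let $$\mathcal D=\{\Psi\in H^1_{loc}(\mathbb R;\mathbb C^2):\ (|\psi_1(x)|,|\psi_2(x)|)\to(1,0)\text{ as }x\to+\infty,\ \to(0,1)\text{ as }x\to-\infty\}.$$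 For $\alpha\in\mathbb R$ and $\theta_1,\theta_2\in\mathbb R/(2\pi\mathbb Z)$ write $\Psi_{\alpha,\theta_1,\theta_2}(x)=(e^{i\theta_1}\psi_1(x+\alpha),e^{i\theta_2}\psi_2(x+\alpha))$, and let $U_1=(u_1,0)$, $U_2=(0,u_2)$. There exists $\varepsilon_0>0$ such that, for every $\Psi\in\mathcal D\cap L^\infty(\mathbb R)$ satisfying $$\inf_{\alpha,\theta_1,\theta_2\in\mathbb R}\|\Psi_{\alpha,\theta_1,\theta_2}-U\|_{\mathcal H}\le\varepsilon_0,$$ there exist $\alpha\in\mathbb R$, $\theta_1\in\mathbb R/(2\pi\mathbb Z)$ and $\theta_2\in\mathbb R/(2\pi\mathbb Z)$ such that $$\Psi_{\alpha,\theta_1,\theta_2}=U+V+iW,$$ where $V,W\in\mathcal H$ are real-valued and satisfy $$\langle V,\partial_xU\rangle_{\mathcal H}=0,\qquad \langle W,U_1\rangle_{\mathcal H}=\langle W,U_2\rangle_{\mathcal H}=0$$ (where $\partial_xU,U_1,U_2\in\mathcal H$). Moreover, the parameters $\alpha=\alpha(\Psi)$, $\theta_1=\theta_1(\Psi)$, $\theta_2=\theta_2(\Psi)$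 can be chosen for all such $\Psi$ simultaneously so that they depend continuously on $\Psi$ with respect to the distance $\|\Phi-\Psi\|_{\mathcal H}$. -/

import Mathlib

open scoped ENNReal Topology ComplexConjugate

noncomputable section

namespace DomainWall

/-- A pair of complex-valued functions `Ψ = (ψ₁, ψ₂)` on the real line; the components `ψ₁, ψ₂`
are indexed by `0, 1 : Fin 2`. -/
abbrev Pair : Type := Fin 2 → ℝ → ℂ

/-- A pair of real-valued functions. -/
abbrev RealPair : Type := Fin 2 → ℝ → ℝ

/-- A pair of real-valued functions, regarded as a pair of complex-valued functions. -/
def toPair (V : RealPair) : Pair := fun j x => (V j x : ℂ)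

/-- `f ∈ H¹_loc(ℝ)`. Elements of `H¹_loc(ℝ)` are represented by their continuous representatives:
these are the functions that are absolutely continuous on every compact interval and have a
locally square-integrable derivative; `deriv f` is then (almost everywhere) the weak derivative. -/
def H1loc (f : ℝ → ℂ) : Prop :=
  ∀ a b : ℝ, AbsolutelyContinuousOnInterval f a b ∧
    MeasureTheory.MemLp (deriv f) 2 (MeasureTheory.volume.restrict (Set.Icc a b))

/-- The energy space `𝒟`: pairs `Ψ ∈ H¹_loc(ℝ)` with `(|ψ₁(x)|, |ψ₂(x)|) → (1, 0)` as `x → +∞` and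
`(|ψ₁(x)|, |ψ₂(x)|) → (0, 1)` as `x → -∞`. -/
structure MemD (Ψ : Pair) : Prop where
  h1loc : ∀ j, H1loc (Ψ j)
  top_fst : Filter.Tendsto (fun x => ‖Ψ 0 x‖) Filter.atTop (𝓝 1)
  top_snd : Filter.Tendsto (fun x => ‖Ψ 1 x‖) Filter.atTop (𝓝 0)
  bot_fst : Filter.Tendsto (fun x => ‖Ψ 0 x‖) Filter.atBot (𝓝 0)
  bot_snd : Filter.Tendsto (fun x => ‖Ψ 1 x‖) Filter.atBot (𝓝 1)

/-- `Ψ ∈ L^∞(ℝ)`. -/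
def MemLinfty (Ψ : Pair) : Prop :=
  ∀ j, MeasureTheory.MemLp (Ψ j) ∞ MeasureTheory.volume

/-- `U = (u₁, u₂)` is a domain wall with coupling parameter `γ`: a real classical solution of
`-u₁'' + (u₁² + γ u₂² - 1) u₁ = 0`, `-u₂'' + (γ u₁² + u₂² - 1) u₂ = 0` with `U → (0, 1)` at `-∞`
and `U → (1, 0)` at `+∞`. -/
structure IsDomainWall (γ : ℝ) (U : RealPair) : Prop where
  contDiff : ∀ j, ContDiff ℝ 2 (U j)
  eq_fst : ∀ x, -deriv (deriv (U 0)) x + ((U 0 x) ^ 2 + γ * (U 1 x) ^ 2 - 1) * U 0 x = 0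
  eq_snd : ∀ x, -deriv (deriv (U 1)) x + (γ * (U 0 x) ^ 2 + (U 1 x) ^ 2 - 1) * U 1 x = 0
  bot_fst : Filter.Tendsto (U 0) Filter.atBot (𝓝 0)
  bot_snd : Filter.Tendsto (U 1) Filter.atBot (𝓝 1)
  top_fst : Filter.Tendsto (U 0) Filter.atTop (𝓝 1)
  top_snd : Filter.Tendsto (U 1) Filter.atTop (𝓝 0)

/-- The weight `(γ - 1) (1 - u_j²)` (nonnegative for every domain wall `U` with `γ > 1`). -/
def weight (γ : ℝ) (U : RealPair) (j : Fin 2) (x : ℝ) : ℝ := (γ - 1) * (1 - (U j x) ^ 2)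

/-- The norm of the weighted space `ℋ`,
`‖Ψ‖² = ∑ⱼ ∫ (|ψ_j'|² + (γ - 1) (1 - u_j²) |ψ_j|²) dx`, with values in `[0, ∞]`
(for `Ψ ∈ H¹_loc(ℝ)`; it is `∞` if `Ψ` is not in `ℋ`). -/
def normH (γ : ℝ) (U : RealPair) (Ψ : Pair) : ℝ≥0∞ :=
  (∑ j, ∫⁻ x, (‖deriv (Ψ j) x‖ₑ ^ 2 + ENNReal.ofReal (weight γ U j x) * ‖Ψ j x‖ₑ ^ 2))
    ^ (1 / 2 : ℝ)

/-- `Ψ ∈ ℋ`. -/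
def MemH (γ : ℝ) (U : RealPair) (Ψ : Pair) : Prop :=
  (∀ j, H1loc (Ψ j)) ∧ normH γ U Ψ < ∞

/-- The inner product of `ℋ`,
`⟨Ψ, Φ⟩ = ∑ⱼ ∫ (ψ_j' conj(φ_j') + (γ - 1) (1 - u_j²) ψ_j conj(φ_j)) dx`. -/
def innerH (γ : ℝ) (U : RealPair) (Ψ Φ : Pair) : ℂ :=
  ∑ j, ∫ x, (deriv (Ψ j) x * conj (deriv (Φ j) x) + (weight γ U j x : ℂ) * Ψ j x * conj (Φ j x))

/-- `Ψ` and `Φ` are elements of `ℋ`, orthogonal to each other. -/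
def OrthH (γ : ℝ) (U : RealPair) (Ψ Φ : Pair) : Prop :=
  MemH γ U Ψ ∧ MemH γ U Φ ∧ innerH γ U Ψ Φ = 0

/-- The transformed pair
`Ψ_{α,θ₁,θ₂}(x) = (exp(i θ₁) ψ₁(x + α), exp(i θ₂) ψ₂(x + α))`, with phases `θ_j ∈ ℝ/(2πℤ)`. -/
def modulate (α : ℝ) (θ : Fin 2 → Real.Angle) (Ψ : Pair) : Pair :=
  fun j x => ((θ j).toCircle : ℂ) * Ψ j (x + α)

/-- The functions `Ψ ∈ 𝒟 ∩ L^∞(ℝ)` with `inf_{α,θ₁,θ₂} ‖Ψ_{α,θ₁,θ₂} - U‖ ≤ ε` in `ℋ`. -/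
def tube (γ : ℝ) (U : RealPair) (ε : ℝ) : Set Pair :=
  {Ψ | MemD Ψ ∧ MemLinfty Ψ ∧
    (⨅ (α : ℝ) (θ₁ : ℝ) (θ₂ : ℝ),
      normH γ U (modulate α ![(θ₁ : Real.Angle), (θ₂ : Real.Angle)] Ψ - toPair U))
        ≤ ENNReal.ofReal ε}

end DomainWall

end

/-! Write w_j for the weight. Integrating by parts once turns the `ℋ` pairing of ψ with a translate
of u_j or u_j' into an ordinary integral ∫ ψ(x) k(x - a) dx, with kernel Z_j = w_j u_j - u_j'' or
Y_j = w_j u_j' - u_j'''. These kernels and their derivatives decay exponentially, while functions of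
finite energy grow at most linearly, with constant controlled by the energy
(`IsDomainWall.exists_growth`). Hence the integrals are jointly continuous in ψ and a, and C¹ in a
because the shift sits on the kernel. The decay comes from a differential inequality v'' ≥ μ² v at
each end of the wall. The maximum principle makes the weights nonnegative. Since U itself has finite
energy, so does every Ψ near its orbit.

The three orthogonality conditions reduce to one scalar equation. Put z_j(a) = ∫ ψ_j Z_j(x - a) and
y_j(a) = ∫ ψ_j Y_j(x - a). Then ⟨W, U_j⟩ = Im(e^{iθ_j} z_j(α)), which vanishes for θ_j = -arg
z_j(α). With these phases, ⟨V, ∂_x U⟩ = 0 becomes Σ_j Re(conj(z_j) y_j)/|z_j| = ⟨U, ∂_x U⟩ at a = α,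
where no phase appears (`posFun`, `posConst`). For Ψ = U and a = 0 the left side has derivative Σ_j
‖u_j'‖² > 0. By continuity its derivative stays bounded below by some κ > 0 near the orbit
(`IsDomainWall.exists_posFun_deriv`), so there is a root, unique in a window of fixed size
(`IsDomainWall.exists_local`).

The root is picked arbitrarily for each Ψ. Continuity holds for any such choice: two approximate
positions of one function are close to each other (`IsDomainWall.abs_sub_lt_of_near`), so the roots
chosen for Ψ and for a nearby Φ lie in a common window. There the lower bound κ converts closeness
of the two equations into closeness of their roots. The phases follow, the argument being continuous
away from 0. -/

noncomputable section

namespace DomainWall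

open Filter Set MeasureTheory

section

/-! ### Exponential decay -/

/-- Exponential decay at `+∞`. -/
def HalfDecay (f : ℝ → ℝ) : Prop :=
  ∃ κ > 0, ∃ C, ∀ x, 0 ≤ x → |f x| ≤ C * Real.exp (-κ * x)

/-- Exponential decay at `±∞`. -/
def ExpDecay (f : ℝ → ℝ) : Prop := HalfDecay f ∧ HalfDecay fun x => f (-x)

/-- `f` is a bounded function. -/
def Bdd (f : ℝ → ℝ) : Prop := ∃ M, ∀ x, |f x| ≤ M

theorem Bdd.add {f g : ℝ → ℝ} (hf : Bdd f) (hg : Bdd g) : Bdd fun x => f x + g x := by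
  obtain ⟨M, hM⟩ := hf
  obtain ⟨N, hN⟩ := hg
  exact ⟨M + N, fun x => (abs_add_le _ _).trans (add_le_add (hM x) (hN x))⟩

theorem Bdd.neg {f : ℝ → ℝ} (hf : Bdd f) : Bdd fun x => -f x := by
  simpa [Bdd] using hf

theorem Bdd.sub {f g : ℝ → ℝ} (hf : Bdd f) (hg : Bdd g) : Bdd fun x => f x - g x := by
  simpa [sub_eq_add_neg] using hf.add hg.neg

theorem Bdd.mul {f g : ℝ → ℝ} (hf : Bdd f) (hg : Bdd g) : Bdd fun x => f x * g x := by
  obtain ⟨M, hM⟩ := hf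
  obtain ⟨N, hN⟩ := hg
  refine ⟨M * N, fun x => ?_⟩
  rw [abs_mul]
  exact mul_le_mul (hM x) (hN x) (abs_nonneg _) ((abs_nonneg _).trans (hM x))

theorem Bdd.pow {f : ℝ → ℝ} (hf : Bdd f) (n : ℕ) : Bdd fun x => f x ^ n := by
  obtain ⟨M, hM⟩ := hf
  refine ⟨M ^ n, fun x => ?_⟩
  rw [abs_pow]
  exact pow_le_pow_left₀ (abs_nonneg _) (hM x) n

theorem Bdd.const (c : ℝ) : Bdd fun _ => c := ⟨|c|, fun _ => le_rfl⟩

theorem Bdd.comp {f : ℝ → ℝ} (hf : Bdd f) (g : ℝ → ℝ) : Bdd fun x => f (g x) :=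
  hf.imp fun _ h x => h (g x)

theorem HalfDecay.add {f g : ℝ → ℝ} (hf : HalfDecay f) (hg : HalfDecay g) :
    HalfDecay fun x => f x + g x := by
  obtain ⟨a, ha, A, hA⟩ := hf
  obtain ⟨b, hb, B, hB⟩ := hg
  have hA0 : 0 ≤ A := by simpa using (abs_nonneg _).trans (hA 0 le_rfl)
  have hB0 : 0 ≤ B := by simpa using (abs_nonneg _).trans (hB 0 le_rfl)
  refine ⟨min a b, lt_min ha hb, A + B, fun x hx => ?_⟩
  have h1 : Real.exp (-a * x) ≤ Real.exp (-(min a b) * x) := by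
    apply Real.exp_le_exp.2
    nlinarith [min_le_left a b]
  have h2 : Real.exp (-b * x) ≤ Real.exp (-(min a b) * x) := by
    apply Real.exp_le_exp.2
    nlinarith [min_le_right a b]
  calc |f x + g x| ≤ |f x| + |g x| := abs_add_le _ _
    _ ≤ A * Real.exp (-(min a b) * x) + B * Real.exp (-(min a b) * x) :=
        add_le_add ((hA x hx).trans (by gcongr)) ((hB x hx).trans (by gcongr))
    _ = _ := by ring

theorem HalfDecay.mul_bdd {f g : ℝ → ℝ} (hf : HalfDecay f) (hg : Bdd g) :
    HalfDecay fun x => f x * g x := by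
  obtain ⟨a, ha, A, hA⟩ := hf
  obtain ⟨M, hM⟩ := hg
  refine ⟨a, ha, A * M, fun x hx => ?_⟩
  rw [abs_mul, mul_right_comm]
  exact mul_le_mul (hA x hx) (hM x) (abs_nonneg _) ((abs_nonneg _).trans (hA x hx))

theorem ExpDecay.add {f g : ℝ → ℝ} (hf : ExpDecay f) (hg : ExpDecay g) :
    ExpDecay fun x => f x + g x := ⟨hf.1.add hg.1, hf.2.add hg.2⟩

theorem ExpDecay.mul_bdd {f g : ℝ → ℝ} (hf : ExpDecay f) (hg : Bdd g) :
    ExpDecay fun x => f x * g x := ⟨hf.1.mul_bdd hg, hf.2.mul_bdd (hg.comp _)⟩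

theorem ExpDecay.neg {f : ℝ → ℝ} (hf : ExpDecay f) : ExpDecay fun x => -f x := by
  simpa [ExpDecay, HalfDecay] using hf

theorem ExpDecay.sub {f g : ℝ → ℝ} (hf : ExpDecay f) (hg : ExpDecay g) :
    ExpDecay fun x => f x - g x := by
  simpa [sub_eq_add_neg] using hf.add hg.neg

theorem ExpDecay.exists_bound {f : ℝ → ℝ} (hf : ExpDecay f) :
    ∃ κ > 0, ∃ C, ∀ x, |f x| ≤ C * Real.exp (-κ * |x|) := by
  obtain ⟨⟨a, ha, A, hA⟩, ⟨b, hb, B, hB⟩⟩ := hf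
  have hA0 : 0 ≤ A := by simpa using (abs_nonneg _).trans (hA 0 le_rfl)
  have hB0 : 0 ≤ B := by simpa using (abs_nonneg _).trans (hB 0 le_rfl)
  refine ⟨min a b, lt_min ha hb, A + B, fun x => ?_⟩
  rcases le_total 0 x with hx | hx
  · rw [abs_of_nonneg hx]
    have h1 : Real.exp (-a * x) ≤ Real.exp (-(min a b) * x) := by
      apply Real.exp_le_exp.2
      nlinarith [min_le_left a b]
    refine (hA x hx).trans ?_
    gcongr
    linarith
  · rw [abs_of_nonpos hx]
    have h1 : Real.exp (-b * -x) ≤ Real.exp (-(min a b) * -x) := by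
      apply Real.exp_le_exp.2
      nlinarith [min_le_right a b]
    have := hB (-x) (by linarith)
    simp only [neg_neg] at this
    refine this.trans ?_
    gcongr
    linarith

theorem ExpDecay.bdd {f : ℝ → ℝ} (hf : ExpDecay f) : Bdd f := by
  obtain ⟨κ, hκ, C, hC⟩ := hf.exists_bound
  have hC0 : 0 ≤ C := by simpa using (abs_nonneg _).trans (hC 0)
  refine ⟨C, fun x => (hC x).trans ?_⟩
  have : Real.exp (-κ * |x|) ≤ 1 := Real.exp_le_one_iff.2 (by nlinarith [abs_nonneg x])
  nlinarith

theorem ExpDecay.congr {f g : ℝ → ℝ} (hf : ExpDecay f) (h : ∀ x, g x = f x) : ExpDecay g := by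
  rwa [show g = f from funext h]

/-- A function with limits at `±∞` is bounded if it is continuous. -/
theorem bdd_of_tendsto {f : ℝ → ℝ} (hf : Continuous f) {a b : ℝ} (ha : Tendsto f atBot (𝓝 a))
    (hb : Tendsto f atTop (𝓝 b)) : Bdd f := by
  have h1 : ∀ᶠ x in atBot, |f x| < |a| + 1 := ha.abs.eventually_lt_const (by linarith)
  have h2 : ∀ᶠ x in atTop, |f x| < |b| + 1 := hb.abs.eventually_lt_const (by linarith)
  obtain ⟨m, hm⟩ := eventually_atBot.1 h1
  obtain ⟨M, hM⟩ := eventually_atTop.1 h2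
  obtain ⟨C, hC⟩ := (isCompact_Icc (a := m) (b := M)).exists_bound_of_continuousOn hf.continuousOn
  refine ⟨max C (max (|a| + 1) (|b| + 1)), fun x => ?_⟩
  by_cases hx : x ≤ m
  · exact (hm x hx).le.trans ((le_max_left _ _).trans (le_max_right _ _))
  by_cases hx' : M ≤ x
  · exact (hM x hx').le.trans ((le_max_right _ _).trans (le_max_right _ _))
  exact (hC x ⟨by linarith, by linarith⟩).trans (le_max_left _ _)

/-- A function tending to `0` which satisfies `v'' ≥ μ² v` decays exponentially. -/
theorem le_exp_of_deriv2_ge {v v' v'' : ℝ → ℝ} (hv : ∀ x, HasDerivAt v (v' x) x)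
    (hv' : ∀ x, HasDerivAt v' (v'' x) x) {μ R : ℝ} (hμ : 0 < μ)
    (h : ∀ x, R ≤ x → μ ^ 2 * v x ≤ v'' x) (hlim : Tendsto v atTop (𝓝 0)) :
    ∀ x, R ≤ x → v x ≤ v R * Real.exp (-μ * (x - R)) := by
  have hE : ∀ (s x : ℝ), HasDerivAt (fun x => Real.exp (s * x)) (s * Real.exp (s * x)) x := by
    intro s x
    have := ((hasDerivAt_id x).const_mul s).exp
    simpa [mul_comm] using this
  have hcont : Continuous v := continuous_iff_continuousAt.2 fun x => (hv x).continuousAt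
  have hcont' : Continuous v' := continuous_iff_continuousAt.2 fun x => (hv' x).continuousAt
  -- `y = v' + μ v` satisfies `y' ≥ μ y`
  have mono : MonotoneOn (fun x => (v' x + μ * v x) * Real.exp (-μ * x)) (Ici R) := by
    refine monotoneOn_of_hasDerivWithinAt_nonneg (convex_Ici R) (by fun_prop)
      (fun x _ => (((hv' x).add ((hv x).const_mul μ)).mul (hE (-μ) x)).hasDerivWithinAt) ?_
    intro x hx
    rw [interior_Ici] at hx
    have h1 := h x (le_of_lt hx)
    have : (v'' x + μ * v' x) * Real.exp (-μ * x)
        + (v' x + μ * v x) * (-μ * Real.exp (-μ * x))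
        = (v'' x - μ ^ 2 * v x) * Real.exp (-μ * x) := by ring
    simp only [Pi.add_apply]
    rw [this]
    exact mul_nonneg (by linarith) (Real.exp_pos _).le
  -- A positive value c of v' + μ v at x₀ would persist as a lower bound. Once μ v < c/2 this gives
  -- v' ≥ c/2, so v → ∞, against v → 0.
  have neg : ∀ x, R ≤ x → v' x + μ * v x ≤ 0 := by
    intro x₀ hx₀
    by_contra! hpos
    set c := v' x₀ + μ * v x₀ with hc
    have hge : ∀ x, x₀ ≤ x → c ≤ v' x + μ * v x := by
      intro x hx
      have := mono (show x₀ ∈ Ici R from hx₀) (show x ∈ Ici R from hx₀.trans hx) hx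
      simp only at this
      rw [← hc] at this
      have e1 : Real.exp (-μ * x) ≤ Real.exp (-μ * x₀) := Real.exp_le_exp.2 (by nlinarith)
      have e2 := Real.exp_pos (-μ * x)
      have : c * Real.exp (-μ * x) ≤ (v' x + μ * v x) * Real.exp (-μ * x) := by nlinarith
      exact le_of_mul_le_mul_right this e2
    have hsmall : ∀ᶠ x in atTop, v x < c / (2 * μ) := hlim.eventually_lt_const (by positivity)
    obtain ⟨M, hM⟩ := eventually_atTop.1 (hsmall.and (eventually_ge_atTop x₀))
    have mono2 : MonotoneOn (fun x => v x - c / 2 * x) (Ici M) := by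
      refine monotoneOn_of_hasDerivWithinAt_nonneg (convex_Ici M) (by fun_prop)
        (fun x _ => ((hv x).sub ((hasDerivAt_id x).const_mul (c / 2))).hasDerivWithinAt) ?_
      intro x hx
      rw [interior_Ici] at hx
      obtain ⟨h1, h2⟩ := hM x (le_of_lt hx)
      have h3 := hge x h2
      have : μ * v x < c / 2 := by
        have := mul_lt_mul_of_pos_left h1 hμ
        rwa [show μ * (c / (2 * μ)) = c / 2 by field_simp] at this
      linarith
    have hbig : Tendsto v atTop atTop := by
      have h1 : Tendsto (fun x => (v M - c / 2 * M) + c / 2 * x) atTop atTop :=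
        tendsto_atTop_add_const_left _ _ (tendsto_id.const_mul_atTop (by positivity))
      refine tendsto_atTop_mono' _ ?_ h1
      filter_upwards [eventually_ge_atTop M] with x hx
      have := mono2 (show M ∈ Ici M from mem_Ici.2 le_rfl) (show x ∈ Ici M from hx) hx
      simp only at this
      linarith
    exact not_tendsto_atTop_of_tendsto_nhds hlim hbig
  have anti : AntitoneOn (fun x => v x * Real.exp (μ * x)) (Ici R) := by
    refine antitoneOn_of_hasDerivWithinAt_nonpos (convex_Ici R) (by fun_prop)
      (fun x _ => ((hv x).mul (hE μ x)).hasDerivWithinAt) ?_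
    intro x hx
    rw [interior_Ici] at hx
    have h1 := neg x (le_of_lt hx)
    have : v' x * Real.exp (μ * x) + v x * (μ * Real.exp (μ * x))
        = (v' x + μ * v x) * Real.exp (μ * x) := by ring
    rw [this]
    exact mul_nonpos_of_nonpos_of_nonneg h1 (Real.exp_pos _).le
  intro x hx
  have := anti (show R ∈ Ici R from mem_Ici.2 le_rfl) (show x ∈ Ici R from hx) hx
  simp only at this
  calc v x = v x * Real.exp (μ * x) * Real.exp (-μ * x) := by
        rw [mul_assoc, ← Real.exp_add]; simp
    _ ≤ v R * Real.exp (μ * R) * Real.exp (-μ * x) := by gcongr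
    _ = _ := by rw [mul_assoc, ← Real.exp_add]; ring_nf

/-- A decay estimate valid near `+∞` holds on `[0, ∞)` with a larger constant. -/
theorem HalfDecay.of_ge {f : ℝ → ℝ} (hf : Continuous f) {κ C R : ℝ} (hκ : 0 < κ)
    (h : ∀ x, R ≤ x → |f x| ≤ C * Real.exp (-κ * x)) : HalfDecay f := by
  obtain ⟨M, hM⟩ := (isCompact_Icc (a := 0) (b := R)).exists_bound_of_continuousOn hf.continuousOn
  refine ⟨κ, hκ, max C (M * Real.exp (κ * R)), fun x hx => ?_⟩
  rcases le_total R x with hR | hR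
  · exact (h x hR).trans (by gcongr; exact le_max_left _ _)
  · have h1 := hM x ⟨hx, hR⟩
    have hM0 : 0 ≤ M := (norm_nonneg _).trans h1
    have h2 : 1 ≤ Real.exp (κ * R) * Real.exp (-κ * x) := by
      rw [← Real.exp_add]
      apply Real.one_le_exp
      nlinarith
    calc |f x| ≤ M := h1
      _ ≤ M * (Real.exp (κ * R) * Real.exp (-κ * x)) := le_mul_of_one_le_right hM0 h2
      _ = M * Real.exp (κ * R) * Real.exp (-κ * x) := by ring
      _ ≤ _ := by gcongr; exact le_max_right _ _

/-- If `f` and `f''` decay exponentially at `+∞`, so does `f'`. -/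
theorem HalfDecay.deriv_of_deriv2 {f f' f'' : ℝ → ℝ} (hf : ∀ x, HasDerivAt f (f' x) x)
    (hf' : ∀ x, HasDerivAt f' (f'' x) x) (h0 : HalfDecay f) (h2 : HalfDecay f'') :
    HalfDecay f' := by
  obtain ⟨a, ha, A, hA⟩ := h0
  obtain ⟨b, hb, B, hB⟩ := h2
  have hA0 : 0 ≤ A := by simpa using (abs_nonneg _).trans (hA 0 le_rfl)
  have hB0 : 0 ≤ B := by simpa using (abs_nonneg _).trans (hB 0 le_rfl)
  refine ⟨min a b, lt_min ha hb, 2 * A + B, fun x hx => ?_⟩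
  have ea : ∀ y, x ≤ y → Real.exp (-a * y) ≤ Real.exp (-(min a b) * x) := by
    intro y hy
    apply Real.exp_le_exp.2
    nlinarith [min_le_left a b]
  have eb : ∀ y, x ≤ y → Real.exp (-b * y) ≤ Real.exp (-(min a b) * x) := by
    intro y hy
    apply Real.exp_le_exp.2
    nlinarith [min_le_right a b]
  -- Mean value theorem twice on the unit interval: f'(ξ) = f(x+1) - f(x), then f'(ξ) - f'(x) =
  -- f''(ζ)(ξ - x).
  obtain ⟨ξ, hξ, e1⟩ := exists_hasDerivAt_eq_slope f f' (show x < x + 1 by linarith)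
    (fun y _ => (hf y).continuousAt.continuousWithinAt) fun y _ => hf y
  obtain ⟨ζ, hζ, e2⟩ := exists_hasDerivAt_eq_slope f' f'' hξ.1
    (fun y _ => (hf' y).continuousAt.continuousWithinAt) fun y _ => hf' y
  rw [show x + 1 - x = 1 by ring, div_one] at e1
  rw [eq_div_iff (by linarith [hξ.1])] at e2
  set E := Real.exp (-(min a b) * x)
  have b1 : |f (x + 1)| ≤ A * E :=
    (hA _ (by linarith)).trans (mul_le_mul_of_nonneg_left (ea _ (by linarith)) hA0)
  have b2 : |f x| ≤ A * E := (hA _ hx).trans (mul_le_mul_of_nonneg_left (ea _ le_rfl) hA0)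
  have b3 : |f'' ζ| ≤ B * E :=
    (hB _ (by linarith [hζ.1])).trans (mul_le_mul_of_nonneg_left (eb _ hζ.1.le) hB0)
  have b4 : |f'' ζ * (ξ - x)| ≤ B * E := by
    rw [abs_mul, abs_of_pos (by linarith [hξ.1] : 0 < ξ - x)]
    exact (mul_le_of_le_one_right (abs_nonneg _) (by linarith [hξ.2])).trans b3
  have : f' x = f (x + 1) - f x - f'' ζ * (ξ - x) := by linarith
  rw [this]
  rw [abs_le] at *
  constructor <;> linarith [b1.1, b1.2, b2.1, b2.2, b4.1, b4.2]

end

section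

/-! ### Decay of a domain wall -/

/-- One end of a domain wall: a solution `(p, q)` of the system, with derivatives `p', q'`, that
tends to `(1, 0)` at `+∞`. -/
structure IsEnd (γ : ℝ) (p q p' q' : ℝ → ℝ) : Prop where
  hp : ∀ x, HasDerivAt p (p' x) x
  hq : ∀ x, HasDerivAt q (q' x) x
  hp' : ∀ x, HasDerivAt p' ((p x ^ 2 + γ * q x ^ 2 - 1) * p x) x
  hq' : ∀ x, HasDerivAt q' ((q x ^ 2 + γ * p x ^ 2 - 1) * q x) x
  lim_p : Tendsto p atTop (𝓝 1)
  lim_q : Tendsto q atTop (𝓝 0)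
  bdd_p : Bdd p
  bdd_q : Bdd q

/-- The squared distance v = (1 - p)² + q² to the limit satisfies v'' ≥ m v near +∞. The
linearisation at (1, 0) is positive definite, with eigenvalues 2 and γ - 1. -/
theorem IsEnd.decay_zeroth {γ : ℝ} (hγ : 1 < γ) {p q p' q' : ℝ → ℝ} (h : IsEnd γ p q p' q') :
    HalfDecay (fun x => 1 - p x) ∧ HalfDecay q := by
  set v : ℝ → ℝ := fun x => (1 - p x) ^ 2 + q x ^ 2 with hvdef
  set v' : ℝ → ℝ := fun x => -2 * ((1 - p x) * p' x) + 2 * (q x * q' x) with hv'def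
  set v'' : ℝ → ℝ := fun x =>
    -2 * (-p' x * p' x + (1 - p x) * ((p x ^ 2 + γ * q x ^ 2 - 1) * p x))
      + 2 * (q' x * q' x + q x * ((q x ^ 2 + γ * p x ^ 2 - 1) * q x)) with hv''def
  have hv : ∀ x, HasDerivAt v (v' x) x := fun x => by
    refine ((((h.hp x).const_sub 1).pow 2).add ((h.hq x).pow 2)).congr_deriv ?_
    simp only [hv'def]
    push_cast
    ring
  have hv' : ∀ x, HasDerivAt v' (v'' x) x := fun x =>
    ((((h.hp x).const_sub 1).mul (h.hp' x)).const_mul (-2)).add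
      (((h.hq x).mul (h.hq' x)).const_mul 2)
  have cp : Continuous p := continuous_iff_continuousAt.2 fun x => (h.hp x).continuousAt
  have cq : Continuous q := continuous_iff_continuousAt.2 fun x => (h.hq x).continuousAt
  -- These bounds give v'' ≥ (1 - p)² + (γ - 1)/2 · q²: the cross term 2γ(1 - p)p q² consumes at
  -- most half of 2(γp² - 1)q² ≥ (γ - 1)q².
  have l1 : ∀ᶠ x in atTop, 1 / 2 < (1 + p x) * p x :=
    ((h.lim_p.const_add 1).mul h.lim_p).eventually_const_lt (by norm_num)
  have l2 : ∀ᶠ x in atTop, (γ - 1) / 2 < γ * p x ^ 2 - 1 :=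
    (((h.lim_p.pow 2).const_mul γ).sub_const 1).eventually_const_lt (by linarith)
  have l3 : ∀ᶠ x in atTop, 2 * γ * ((1 - p x) * p x) < (γ - 1) / 2 :=
    (((h.lim_p.const_sub 1).mul h.lim_p).const_mul (2 * γ)).eventually_lt_const (by linarith)
  obtain ⟨R, hR⟩ := eventually_atTop.1 (l1.and (l2.and l3))
  set m := min 1 ((γ - 1) / 2) with hm
  have hm0 : 0 < m := lt_min one_pos (by linarith)
  have hlim : Tendsto v atTop (𝓝 0) := by
    simpa using ((h.lim_p.const_sub 1).pow 2).add (h.lim_q.pow 2)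
  have key := le_exp_of_deriv2_ge (μ := Real.sqrt m) (R := R) hv hv' (Real.sqrt_pos.2 hm0)
    (fun x hx => by
      obtain ⟨h1, h2, h3⟩ := hR x hx
      rw [Real.sq_sqrt hm0.le]
      simp only [hvdef, hv''def]
      have m1 : m ≤ 1 := min_le_left _ _
      have m2 : m ≤ (γ - 1) / 2 := min_le_right _ _
      have e1 := mul_nonneg (sq_nonneg (1 - p x)) (sub_nonneg.2 h1.le)
      have e2 := mul_nonneg (sq_nonneg (q x)) (sub_nonneg.2 h2.le)
      have e3 := mul_nonneg (sq_nonneg (q x)) (sub_nonneg.2 h3.le)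
      have e4 := mul_nonneg (sq_nonneg (1 - p x)) (sub_nonneg.2 m1)
      have e5 := mul_nonneg (sq_nonneg (q x)) (sub_nonneg.2 m2)
      have e6 := sq_nonneg (q x ^ 2)
      have e7 := sq_nonneg (p' x)
      have e8 := sq_nonneg (q' x)
      linarith) hlim
  set μ := Real.sqrt m
  have hμ : 0 < μ := Real.sqrt_pos.2 hm0
  have hv0 : ∀ x, 0 ≤ v x := fun x => by positivity
  -- Taking square roots halves the rate μ of v.
  have final : ∀ f : ℝ → ℝ, (∀ x, f x ^ 2 ≤ v x) → ∀ x, R ≤ x →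
      |f x| ≤ (Real.sqrt (v R) * Real.exp (μ / 2 * R)) * Real.exp (-(μ / 2) * x) := by
    intro f hf x hx
    refine abs_le_of_sq_le_sq ?_ (by positivity)
    refine (hf x).trans ((key x hx).trans (le_of_eq ?_))
    rw [mul_pow, mul_pow, Real.sq_sqrt (hv0 R), ← Real.exp_nat_mul, ← Real.exp_nat_mul, mul_assoc,
      ← Real.exp_add]
    congr 2
    push_cast
    ring
  refine ⟨HalfDecay.of_ge (by fun_prop) (half_pos hμ) (final _ fun x => ?_),
    HalfDecay.of_ge cq (half_pos hμ) (final _ fun x => ?_)⟩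
  · simp only [hvdef]; nlinarith [sq_nonneg (q x)]
  · simp only [hvdef]; nlinarith [sq_nonneg (1 - p x)]

theorem IsEnd.decay_first {γ : ℝ} (hγ : 1 < γ) {p q p' q' : ℝ → ℝ} (h : IsEnd γ p q p' q') :
    HalfDecay p' ∧ HalfDecay q' := by
  obtain ⟨h1, h2⟩ := h.decay_zeroth hγ
  have bp := h.bdd_p
  have bq := h.bdd_q
  constructor
  -- Applied to 1 - p, since p itself tends to 1. Its second derivative is (1 - p)(1 + p)p - γ q² p,
  -- each term carrying a decaying factor.
  · have := HalfDecay.deriv_of_deriv2 (f := fun x => 1 - p x) (f' := fun x => -p' x)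
      (f'' := fun x => -((p x ^ 2 + γ * q x ^ 2 - 1) * p x))
      (fun x => (h.hp x).const_sub 1) (fun x => (h.hp' x).neg) h1 ?_
    · simpa [HalfDecay] using this
    · have a1 := h1.mul_bdd (((Bdd.const 1).add bp).mul bp)
      have a2 := h2.mul_bdd (((Bdd.const (-γ)).mul bq).mul bp)
      convert a1.add a2 using 2 with x
      ring
  · refine HalfDecay.deriv_of_deriv2 h.hq h.hq' h2 ?_
    have a2 := h2.mul_bdd (((bq.pow 2).add ((Bdd.const γ).mul (bp.pow 2))).sub (Bdd.const 1))
    convert a2 using 2 with x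
    ring

variable {γ : ℝ} {U : RealPair}

/-- The second derivative `u_j''`, as a polynomial in `u₁, u₂`. -/
def accel (γ : ℝ) (U : RealPair) (j : Fin 2) (x : ℝ) : ℝ :=
  (U j x ^ 2 + γ * U j.rev x ^ 2 - 1) * U j x

theorem IsDomainWall.hasDerivAt (hU : IsDomainWall γ U) (j : Fin 2) (x : ℝ) :
    HasDerivAt (U j) (deriv (U j) x) x :=
  ((hU.contDiff j).differentiable (by norm_num) x).hasDerivAt

/-- Replacing u_j'' by the polynomial `accel` lets the C² regularity bootstrap: third and fourth
derivatives exist and are again polynomials in u and u'. -/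
theorem IsDomainWall.hasDerivAt_deriv (hU : IsDomainWall γ U) (j : Fin 2) (x : ℝ) :
    HasDerivAt (deriv (U j)) (accel γ U j x) x := by
  have hd : DifferentiableAt ℝ (deriv (U j)) x :=
    ((contDiff_succ_iff_deriv (n := 1)).1 (hU.contDiff j)).2.2.differentiable (by norm_num) x
  have : accel γ U j x = deriv (deriv (U j)) x := by
    fin_cases j
    · have := hU.eq_fst x
      simp [accel]
      linarith
    · have := hU.eq_snd x
      simp [accel]
      linarith
  rw [this]
  exact hd.hasDerivAt

theorem IsDomainWall.continuous (hU : IsDomainWall γ U) (j : Fin 2) : Continuous (U j) :=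
  (hU.contDiff j).continuous

theorem IsDomainWall.continuous_deriv (hU : IsDomainWall γ U) (j : Fin 2) :
    Continuous (deriv (U j)) :=
  (hU.contDiff j).continuous_deriv (by norm_num)

theorem IsDomainWall.bdd (hU : IsDomainWall γ U) (j : Fin 2) : Bdd (U j) := by
  fin_cases j
  · exact bdd_of_tendsto (hU.continuous 0) hU.bot_fst hU.top_fst
  · exact bdd_of_tendsto (hU.continuous 1) hU.bot_snd hU.top_snd

theorem IsDomainWall.isEnd_top (hU : IsDomainWall γ U) :
    IsEnd γ (U 0) (U 1) (deriv (U 0)) (deriv (U 1)) where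
  hp := hU.hasDerivAt 0
  hq := hU.hasDerivAt 1
  hp' := hU.hasDerivAt_deriv 0
  hq' := hU.hasDerivAt_deriv 1
  lim_p := hU.top_fst
  lim_q := hU.top_snd
  bdd_p := hU.bdd 0
  bdd_q := hU.bdd 1

theorem hasDerivAt_comp_neg {f : ℝ → ℝ} {f' x : ℝ} (h : HasDerivAt f f' (-x)) :
    HasDerivAt (fun x => f (-x)) (-f') x :=
  (h.comp x (hasDerivAt_neg x)).congr_deriv (by simp)

/-- Reflecting x and swapping the components is a symmetry of the system that exchanges the two
ends. -/
theorem IsDomainWall.isEnd_bot (hU : IsDomainWall γ U) :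
    IsEnd γ (fun x => U 1 (-x)) (fun x => U 0 (-x)) (fun x => -deriv (U 1) (-x))
      (fun x => -deriv (U 0) (-x)) where
  hp x := hasDerivAt_comp_neg (hU.hasDerivAt 1 (-x))
  hq x := hasDerivAt_comp_neg (hU.hasDerivAt 0 (-x))
  hp' x := by simpa using! (hasDerivAt_comp_neg (hU.hasDerivAt_deriv 1 (-x))).neg
  hq' x := by simpa using! (hasDerivAt_comp_neg (hU.hasDerivAt_deriv 0 (-x))).neg
  lim_p := hU.bot_snd.comp tendsto_neg_atTop_atBot
  lim_q := hU.bot_fst.comp tendsto_neg_atTop_atBot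
  bdd_p := (hU.bdd 1).comp _
  bdd_q := (hU.bdd 0).comp _

theorem IsDomainWall.decay_deriv (hU : IsDomainWall γ U) (hγ : 1 < γ) (j : Fin 2) :
    ExpDecay (deriv (U j)) := by
  have h1 := hU.isEnd_top.decay_first hγ
  have h2 := hU.isEnd_bot.decay_first hγ
  fin_cases j
  · exact ⟨h1.1, by simpa [HalfDecay] using h2.2⟩
  · exact ⟨h1.2, by simpa [HalfDecay] using h2.1⟩

theorem IsDomainWall.decay_mul_rev (hU : IsDomainWall γ U) (hγ : 1 < γ) (j : Fin 2) :
    ExpDecay fun x => U j x * U j.rev x := by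
  have h1 := hU.isEnd_top.decay_zeroth hγ
  have h2 := hU.isEnd_bot.decay_zeroth hγ
  have h3 := h1.2.mul_bdd (hU.bdd 0)
  have h4 := h2.2.mul_bdd ((hU.bdd 1).comp Neg.neg)
  fin_cases j
  · exact ⟨by convert h3 using 2; exact mul_comm _ _, h4⟩
  · exact ⟨h3, by convert h4 using 2; exact mul_comm _ _⟩

/-- At the end where u_j → 1 the factor 1 - u_j decays. At the other end u_j itself does. -/
theorem IsDomainWall.decay_weight_mul (hU : IsDomainWall γ U) (hγ : 1 < γ) (j : Fin 2) :
    ExpDecay fun x => weight γ U j x * U j x := by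
  have h1 := hU.isEnd_top.decay_zeroth hγ
  have h2 := hU.isEnd_bot.decay_zeroth hγ
  have b1 : ∀ j, Bdd fun x => (γ - 1) * ((1 + U j x) * U j x) := fun j =>
    (Bdd.const _).mul (((Bdd.const 1).add (hU.bdd j)).mul (hU.bdd j))
  have b2 : ∀ j, Bdd fun x => (γ - 1) * (1 - U j x ^ 2) := fun j =>
    (Bdd.const _).mul ((Bdd.const 1).sub ((hU.bdd j).pow 2))
  fin_cases j
  · refine ⟨?_, ?_⟩
    · convert h1.1.mul_bdd (b1 0) using 2
      simp [weight]; ring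
    · convert h2.2.mul_bdd ((b2 0).comp Neg.neg) using 2
      simp [weight]; ring
  · refine ⟨?_, ?_⟩
    · convert h1.2.mul_bdd (b2 1) using 2
      simp [weight]; ring
    · convert h2.1.mul_bdd ((b1 1).comp Neg.neg) using 2
      simp [weight]; ring

/-- From u_j'' = -(γ - 1)⁻¹ w_j u_j + γ (u_j u_k) u_k, with k the other index. -/
theorem IsDomainWall.decay_accel (hU : IsDomainWall γ U) (hγ : 1 < γ) (j : Fin 2) :
    ExpDecay (accel γ U j) := by
  have h1 := (hU.decay_weight_mul hγ j).mul_bdd (Bdd.const (-(γ - 1)⁻¹))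
  have h2 := (hU.decay_mul_rev hγ j).mul_bdd ((Bdd.const γ).mul (hU.bdd j.rev))
  have : γ - 1 ≠ 0 := by linarith
  refine (h1.add h2).congr fun x => ?_
  simp only [accel, weight]
  field_simp
  ring

/-- The maximum principle: `u₁² + u₂² ≤ 1`. -/
theorem IsDomainWall.sq_add_sq_le_one (hU : IsDomainWall γ U) (hγ : 1 < γ) (x : ℝ) :
    U 0 x ^ 2 + U 1 x ^ 2 ≤ 1 := by
  by_contra! hx
  set ρ : ℝ → ℝ := fun x => U 0 x ^ 2 + U 1 x ^ 2 with hρ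
  have c0 := hU.continuous 0
  have c1 := hU.continuous 1
  have ltop : Tendsto ρ atTop (𝓝 1) := by
    simpa using (hU.top_fst.pow 2).add (hU.top_snd.pow 2)
  have lbot : Tendsto ρ atBot (𝓝 1) := by
    simpa using (hU.bot_fst.pow 2).add (hU.bot_snd.pow 2)
  -- Both limits of ρ equal 1, so a value above 1 forces an attained global maximum.
  obtain ⟨y, hy⟩ := Continuous.exists_forall_ge' (f := ρ) (by fun_prop) x (by
    rw [_root_.cocompact_eq_atBot_atTop, eventually_sup]
    exact ⟨lbot.eventually_le_const hx, ltop.eventually_le_const hx⟩)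
  have hy1 : 1 < ρ y := hx.trans_le (hy x)
  have d1 : ∀ t, HasDerivAt ρ (2 * (U 0 t * deriv (U 0) t) + 2 * (U 1 t * deriv (U 1) t)) t := by
    intro t
    refine (((hU.hasDerivAt 0 t).pow 2).add ((hU.hasDerivAt 1 t).pow 2)).congr_deriv ?_
    push_cast
    ring
  have e1 : deriv ρ = fun t => 2 * (U 0 t * deriv (U 0) t) + 2 * (U 1 t * deriv (U 1) t) :=
    funext fun t => (d1 t).deriv
  have d2 := (((hU.hasDerivAt 0 y).mul (hU.hasDerivAt_deriv 0 y)).const_mul 2).add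
    (((hU.hasDerivAt 1 y).mul (hU.hasDerivAt_deriv 1 y)).const_mul 2)
  have e2 := d2.deriv
  rw [show ((fun y => 2 * (U 0 * deriv (U 0)) y) + fun y => 2 * (U 1 * deriv (U 1)) y) = deriv ρ
    from e1.symm] at e2
  have hmax : IsLocalMax ρ y := Eventually.of_forall hy
  -- The equations give ρ''/2 = |u'|² + ρ(ρ - 1) + 2(γ - 1)(u₁u₂)².
  have hpos : 0 < deriv (deriv ρ) y := by
    rw [e2]
    simp only [accel, Fin.rev_zero, Fin.reduceLast, hρ, show (1 : Fin 2).rev = 0 from rfl] at hy1 ⊢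
    have a1 := sq_nonneg (deriv (U 0) y)
    have a2 := sq_nonneg (deriv (U 1) y)
    have a3 : 0 < (U 0 y ^ 2 + U 1 y ^ 2) * (U 0 y ^ 2 + U 1 y ^ 2 - 1) :=
      mul_pos (by linarith) (by linarith)
    have a4 : 0 ≤ (γ - 1) * (U 0 y * U 1 y) ^ 2 := mul_nonneg (by linarith) (sq_nonneg _)
    linarith
  -- A maximum with ρ'' > 0 is also a strict-convexity minimum, so ρ is locally constant, which
  -- contradicts ρ'' > 0.
  have hmin := isLocalMin_of_deriv_deriv_pos hpos hmax.deriv_eq_zero (d1 y).continuousAt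
  have hconst : ρ =ᶠ[𝓝 y] fun _ => ρ y := by
    filter_upwards [hmax, hmin] with t h1 h2 using le_antisymm h1 h2
  have : deriv (deriv ρ) y = 0 := by
    rw [hconst.deriv.deriv_eq]
    simp
  exact hpos.ne' this

theorem IsDomainWall.sq_le_one (hU : IsDomainWall γ U) (hγ : 1 < γ) (j : Fin 2) (x : ℝ) :
    U j x ^ 2 ≤ 1 := by
  have := hU.sq_add_sq_le_one hγ x
  fin_cases j
  · exact le_trans (le_add_of_nonneg_right (sq_nonneg _)) this
  · exact le_trans (le_add_of_nonneg_left (sq_nonneg _)) this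

theorem IsDomainWall.weight_nonneg (hU : IsDomainWall γ U) (hγ : 1 < γ) (j : Fin 2) (x : ℝ) :
    0 ≤ weight γ U j x :=
  mul_nonneg (by linarith) (by linarith [hU.sq_le_one hγ j x])

theorem IsDomainWall.continuous_weight (hU : IsDomainWall γ U) (j : Fin 2) :
    Continuous (weight γ U j) := by
  have := hU.continuous j
  unfold weight
  fun_prop

theorem IsDomainWall.bdd_weight (hU : IsDomainWall γ U) (j : Fin 2) :
    Bdd (weight γ U j) :=
  (Bdd.const _).mul ((Bdd.const 1).sub ((hU.bdd j).pow 2))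

theorem IsDomainWall.hasDerivAt_weight (hU : IsDomainWall γ U) (j : Fin 2) (x : ℝ) :
    HasDerivAt (weight γ U j) (deriv (U j) x * (-2 * (γ - 1) * U j x)) x := by
  refine ((((hU.hasDerivAt j x).pow 2).const_sub 1).const_mul (γ - 1)).congr_deriv ?_
  push_cast
  ring

end

section

/-! ### Absolutely continuous functions and `H¹_loc` -/

open AbsolutelyContinuousOnInterval in
theorem _root_.AbsolutelyContinuousOnInterval.comp_add_right {X : Type*} [PseudoMetricSpace X]
    {f : ℝ → X} {s t a : ℝ} (hf : AbsolutelyContinuousOnInterval f (s + a) (t + a)) :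
    AbsolutelyContinuousOnInterval (fun x => f (x + a)) s t := by
  rw [absolutelyContinuousOnInterval_iff] at hf ⊢
  intro ε hε
  obtain ⟨δ, hδ, H⟩ := hf ε hε
  refine ⟨δ, hδ, fun E hE hEδ => ?_⟩
  have key : ∀ u v x : ℝ, x ∈ uIoc (u + a) (v + a) → x - a ∈ uIoc u v := by
    intro u v x hx
    rw [uIoc, mem_Ioc, min_add_add_right, max_add_add_right] at hx
    rw [uIoc, mem_Ioc]
    constructor <;> linarith [hx.1, hx.2]
  have key' : ∀ u : ℝ, u ∈ uIcc s t → u + a ∈ uIcc (s + a) (t + a) := by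
    intro u hu
    rw [uIcc, mem_Icc] at hu ⊢
    rw [min_add_add_right, max_add_add_right]
    constructor <;> linarith [hu.1, hu.2]
  refine H (E.1, fun i => ((E.2 i).1 + a, (E.2 i).2 + a)) ⟨?_, ?_⟩ ?_
  · exact fun i hi => ⟨key' _ (hE.1 i hi).1, key' _ (hE.1 i hi).2⟩
  · intro i hi k hk hik
    have := hE.2 hi hk hik
    simp only [Function.onFun] at this ⊢
    rw [Set.disjoint_left] at this ⊢
    exact fun x hx hx' => this (key _ _ x hx) (key _ _ x hx')
  · simpa using hEδ

-- Serves the real and imaginary parts, through which the fundamental theorem of calculus is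
-- reached.
open AbsolutelyContinuousOnInterval in
theorem _root_.AbsolutelyContinuousOnInterval.of_dist_le {X Y : Type*} [PseudoMetricSpace X]
    [PseudoMetricSpace Y] {f : ℝ → X} {g : ℝ → Y} {s t : ℝ}
    (hf : AbsolutelyContinuousOnInterval f s t) (h : ∀ x y, dist (g x) (g y) ≤ dist (f x) (f y)) :
    AbsolutelyContinuousOnInterval g s t := by
  rw [absolutelyContinuousOnInterval_iff] at hf ⊢
  intro ε hε
  obtain ⟨δ, hδ, H⟩ := hf ε hε
  exact ⟨δ, hδ, fun E hE hEδ => (Finset.sum_le_sum fun i _ => h _ _).trans_lt (H E hE hEδ)⟩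

variable {f g : ℝ → ℂ}

theorem H1loc.continuous (hf : H1loc f) : Continuous f := by
  refine continuous_iff_continuousAt.2 fun x => ?_
  refine (hf (x - 1) (x + 1)).1.continuousOn.continuousAt ?_
  rw [uIcc_of_le (by linarith)]
  exact Icc_mem_nhds (by linarith) (by linarith)

theorem H1loc.ae_differentiableAt (hf : H1loc f) : ∀ᵐ x, DifferentiableAt ℝ f x := by
  refine LocallyBoundedVariationOn.ae_differentiableAt fun a b _ _ => ?_
  exact (hf a b).1.boundedVariationOn.mono (inter_subset_right.trans Icc_subset_uIcc)

theorem H1loc.add (hf : H1loc f) (hg : H1loc g) : H1loc fun x => f x + g x := by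
  refine fun a b => ⟨(hf a b).1.fun_add (hg a b).1, ?_⟩
  refine ((hf a b).2.add (hg a b).2).ae_eq (ae_restrict_of_ae ?_)
  filter_upwards [hf.ae_differentiableAt, hg.ae_differentiableAt] with x h1 h2
  exact (deriv_fun_add h1 h2).symm

theorem H1loc.const_mul (hf : H1loc f) (c : ℂ) : H1loc fun x => c * f x := by
  refine fun a b => ⟨(hf a b).1.const_smul c, ?_⟩
  rw [deriv_const_mul_field']
  exact (hf a b).2.const_mul c

theorem H1loc.sub (hf : H1loc f) (hg : H1loc g) : H1loc fun x => f x - g x := by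
  simpa [sub_eq_add_neg] using hf.add (hg.const_mul (-1))

theorem H1loc.comp_add_right (hf : H1loc f) (s : ℝ) : H1loc fun x => f (x + s) := by
  refine fun a b => ⟨(hf (a + s) (b + s)).1.comp_add_right, ?_⟩
  rw [show deriv (fun x => f (x + s)) = fun x => deriv f (x + s) from
    funext fun x => deriv_comp_add_const f s x]
  have h1 := (measurePreserving_add_right (volume : Measure ℝ) s).restrict_preimage
    (measurableSet_Icc (a := a + s) (b := b + s))
  rw [show (fun x => x + s) ⁻¹' Icc (a + s) (b + s) = Icc a b by ext; simp] at h1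
  exact (hf (a + s) (b + s)).2.comp_measurePreserving h1

theorem hasDerivAt_re {z : ℂ} {x : ℝ} (h : HasDerivAt f z x) :
    HasDerivAt (fun x => (f x).re) z.re x :=
  (Complex.reCLM.hasFDerivAt.comp_hasDerivAt x h)

theorem hasDerivAt_im {z : ℂ} {x : ℝ} (h : HasDerivAt f z x) :
    HasDerivAt (fun x => (f x).im) z.im x :=
  (Complex.imCLM.hasFDerivAt.comp_hasDerivAt x h)

theorem H1loc.ae_deriv_re (hf : H1loc f) :
    ∀ᵐ x, deriv (fun x => ((f x).re : ℂ)) x = ((deriv f x).re : ℂ) := by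
  filter_upwards [hf.ae_differentiableAt] with x hx
  exact (hasDerivAt_re hx.hasDerivAt).ofReal_comp.deriv

theorem H1loc.ae_deriv_im (hf : H1loc f) :
    ∀ᵐ x, deriv (fun x => ((f x).im : ℂ)) x = ((deriv f x).im : ℂ) := by
  filter_upwards [hf.ae_differentiableAt] with x hx
  exact (hasDerivAt_im hx.hasDerivAt).ofReal_comp.deriv

theorem H1loc.re (hf : H1loc f) : H1loc fun x => ((f x).re : ℂ) := by
  refine fun a b => ⟨(hf a b).1.of_dist_le fun x y => ?_, ?_⟩
  · rw [dist_eq_norm, dist_eq_norm, ← Complex.ofReal_sub, ← Complex.sub_re, Complex.norm_real]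
    exact Complex.abs_re_le_norm _
  · refine (hf a b).2.of_le (aestronglyMeasurable_deriv _ _) (ae_restrict_of_ae ?_)
    filter_upwards [hf.ae_deriv_re] with x hx
    rw [hx, Complex.norm_real]
    exact Complex.abs_re_le_norm _

theorem H1loc.im (hf : H1loc f) : H1loc fun x => ((f x).im : ℂ) := by
  refine fun a b => ⟨(hf a b).1.of_dist_le fun x y => ?_, ?_⟩
  · rw [dist_eq_norm, dist_eq_norm, ← Complex.ofReal_sub, ← Complex.sub_im, Complex.norm_real]
    exact Complex.abs_im_le_norm _
  · refine (hf a b).2.of_le (aestronglyMeasurable_deriv _ _) (ae_restrict_of_ae ?_)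
    filter_upwards [hf.ae_deriv_im] with x hx
    rw [hx, Complex.norm_real]
    exact Complex.abs_im_le_norm _

theorem H1loc.of_hasDerivAt {u u' : ℝ → ℝ} (hu : ∀ x, HasDerivAt u (u' x) x)
    (hu' : Continuous u') : H1loc fun x => (u x : ℂ) := by
  have hd : deriv (fun x => (u x : ℂ)) = fun x => (u' x : ℂ) :=
    funext fun x => (hu x).ofReal_comp.deriv
  refine fun a b => ⟨ContDiffOn.absolutelyContinuousOnInterval (ContDiff.contDiffOn ?_), ?_⟩
  · rw [contDiff_one_iff_deriv, hd]
    exact ⟨fun x => (hu x).ofReal_comp.differentiableAt, by fun_prop⟩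
  · rw [hd]
    have hc : Continuous fun x => (u' x : ℂ) := by fun_prop
    obtain ⟨C, hC⟩ := (isCompact_Icc (a := a) (b := b)).exists_bound_of_continuousOn hc.continuousOn
    exact MemLp.of_bound hc.aestronglyMeasurable C
      ((ae_restrict_iff' measurableSet_Icc).2 (Eventually.of_forall hC))

theorem H1loc.intervalIntegrable_deriv (hf : H1loc f) (a b : ℝ) :
    IntervalIntegrable (deriv f) volume a b := by
  have h : IntegrableOn (deriv f) (uIcc a b) volume :=
    ((hf (min a b) (max a b)).2.integrable (by norm_num) :)
  exact h.intervalIntegrable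

/-- The fundamental theorem of calculus for complex-valued functions. -/
theorem H1loc.integral_deriv (hf : H1loc f) (a b : ℝ) : ∫ x in a..b, deriv f x = f b - f a := by
  have hi := hf.intervalIntegrable_deriv a b
  have h1 := ((hf a b).1.of_dist_le (g := fun x => (f x).re) fun x y => by
    rw [Real.dist_eq, dist_eq_norm, ← Complex.sub_re]
    exact Complex.abs_re_le_norm _).integral_deriv_eq_sub
  have h2 := ((hf a b).1.of_dist_le (g := fun x => (f x).im) fun x y => by
    rw [Real.dist_eq, dist_eq_norm, ← Complex.sub_im]
    exact Complex.abs_im_le_norm _).integral_deriv_eq_sub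
  apply Complex.ext
  · rw [Complex.sub_re, ← h1]
    rw [← Complex.reCLM_apply, ← ContinuousLinearMap.intervalIntegral_comp_comm _ hi]
    refine intervalIntegral.integral_congr_ae ?_
    filter_upwards [hf.ae_differentiableAt] with x hx _
    exact (hasDerivAt_re hx.hasDerivAt).deriv.symm
  · rw [Complex.sub_im, ← h2]
    rw [← Complex.imCLM_apply, ← ContinuousLinearMap.intervalIntegral_comp_comm _ hi]
    refine intervalIntegral.integral_congr_ae ?_
    filter_upwards [hf.ae_differentiableAt] with x hx _
    exact (hasDerivAt_im hx.hasDerivAt).deriv.symm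

theorem H1loc.mul_real (hf : H1loc f) {k k' : ℝ → ℝ} (hk : ∀ x, HasDerivAt k (k' x) x)
    (hk' : Continuous k') : H1loc fun x => f x * (k x : ℂ) := by
  have hkc := H1loc.of_hasDerivAt hk hk'
  intro a b
  refine ⟨(hf a b).1.fun_smul (hkc a b).1, ?_⟩
  have ck : Continuous k := continuous_iff_continuousAt.2 fun x => (hk x).continuousAt
  have cf := hf.continuous
  obtain ⟨C, hC⟩ := (isCompact_Icc (a := a) (b := b)).exists_bound_of_continuousOn ck.continuousOn
  have m1 : MemLp (fun x => (k x : ℂ) * deriv f x) 2 (volume.restrict (Icc a b)) := by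
    refine (hf a b).2.of_le_mul (c := C) (Continuous.aestronglyMeasurable (by fun_prop) |>.mul
      (aestronglyMeasurable_deriv _ _)) ?_
    refine (ae_restrict_iff' measurableSet_Icc).2 (Eventually.of_forall fun x hx => ?_)
    rw [norm_mul, Complex.norm_real]
    exact mul_le_mul_of_nonneg_right (hC x hx) (norm_nonneg _)
  have hc2 : Continuous fun x => f x * (k' x : ℂ) := by fun_prop
  obtain ⟨D, hD⟩ := (isCompact_Icc (a := a) (b := b)).exists_bound_of_continuousOn hc2.continuousOn
  have m2 : MemLp (fun x => f x * (k' x : ℂ)) 2 (volume.restrict (Icc a b)) :=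
    MemLp.of_bound hc2.aestronglyMeasurable D
      ((ae_restrict_iff' measurableSet_Icc).2 (Eventually.of_forall hD))
  refine (m1.add m2).ae_eq (ae_restrict_of_ae ?_)
  filter_upwards [hf.ae_differentiableAt] with x hx
  have := hx.hasDerivAt.mul (hk x).ofReal_comp
  rw [show deriv (fun x => f x * (k x : ℂ)) x = _ from this.deriv]
  simp only [Pi.add_apply]
  ring

/-- `|f(x) - f(t)|² ≤ |x - t| ‖f'‖²`. -/
theorem H1loc.norm_sub_sq_le (hf : H1loc f) (hi : Integrable fun x => ‖deriv f x‖ ^ 2) {N : ℝ}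
    (hN : ∫ x, ‖deriv f x‖ ^ 2 ≤ N) (x t : ℝ) : ‖f x - f t‖ ^ 2 ≤ |x - t| * N := by
  wlog h : t ≤ x generalizing x t
  · rw [norm_sub_rev, abs_sub_comm]
    exact this t x (by linarith)
  rw [abs_of_nonneg (by linarith), ← hf.integral_deriv t x]
  set D := ∫ y in t..x, ‖deriv f y‖ with hD
  have hle : ‖∫ y in t..x, deriv f y‖ ≤ D := intervalIntegral.norm_integral_le_integral_norm h
  have hD0 : 0 ≤ D := (norm_nonneg _).trans hle
  -- Cauchy–Schwarz in the form ∫ (l - |f'|)² ≥ 0; the optimal l = D / (x - t) is inserted below.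
  have key : ∀ l : ℝ, 2 * l * D ≤ l ^ 2 * (x - t) + N := by
    intro l
    have i1 : IntervalIntegrable (fun y => ‖deriv f y‖) volume t x :=
      (hf.intervalIntegrable_deriv t x).norm
    have i2 : IntervalIntegrable (fun y => ‖deriv f y‖ ^ 2) volume t x := hi.intervalIntegrable
    have e : ∫ y in t..x, (l ^ 2 + ‖deriv f y‖ ^ 2 - 2 * l * ‖deriv f y‖)
        = l ^ 2 * (x - t) + (∫ y in t..x, ‖deriv f y‖ ^ 2) - 2 * l * D := by
      rw [intervalIntegral.integral_sub (intervalIntegrable_const.add i2) (i1.const_mul _),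
        intervalIntegral.integral_add intervalIntegrable_const i2,
        intervalIntegral.integral_const, intervalIntegral.integral_const_mul,
        ← hD, smul_eq_mul]
      ring
    have pos : 0 ≤ ∫ y in t..x, (l ^ 2 + ‖deriv f y‖ ^ 2 - 2 * l * ‖deriv f y‖) :=
      intervalIntegral.integral_nonneg h fun y _ => by nlinarith [sq_nonneg (l - ‖deriv f y‖)]
    have le : ∫ y in t..x, ‖deriv f y‖ ^ 2 ≤ N := by
      refine le_trans ?_ hN
      rw [intervalIntegral.integral_of_le h]
      exact setIntegral_le_integral hi (Eventually.of_forall fun y => by positivity)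
    linarith
  have hN0 : 0 ≤ N := (integral_nonneg fun y => by positivity).trans hN
  refine (pow_le_pow_left₀ (norm_nonneg _) hle 2).trans ?_
  rcases h.eq_or_lt with rfl | h
  · simp [hD]
  · have hpos : 0 < x - t := by linarith
    have := key (D / (x - t))
    have e1 : 2 * (D / (x - t)) * D = 2 * (D ^ 2 / (x - t)) := by ring
    have e2 : (D / (x - t)) ^ 2 * (x - t) = D ^ 2 / (x - t) := by field_simp
    rw [e1, e2] at this
    have : D ^ 2 / (x - t) ≤ N := by linarith
    rw [div_le_iff₀ hpos] at this
    linarith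

end

section

/-! ### The energy of one component -/

variable {γ : ℝ} {U : RealPair} {f g : ℝ → ℂ} {j : Fin 2}

/-- The contribution of one component to the square of the norm of `ℋ`. -/
def energy (γ : ℝ) (U : RealPair) (j : Fin 2) (f : ℝ → ℂ) : ℝ≥0∞ :=
  ∫⁻ x, (‖deriv f x‖ₑ ^ 2 + ENNReal.ofReal (weight γ U j x) * ‖f x‖ₑ ^ 2)

theorem normH_eq (γ : ℝ) (U : RealPair) (Ψ : Pair) :
    normH γ U Ψ = (∑ j, energy γ U j (Ψ j)) ^ (1 / 2 : ℝ) := rfl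

theorem normH_lt_top_iff (γ : ℝ) (U : RealPair) (Ψ : Pair) :
    normH γ U Ψ < ∞ ↔ ∀ j, energy γ U j (Ψ j) < ∞ := by
  rw [normH_eq, ENNReal.rpow_lt_top_iff_of_pos (by norm_num), ENNReal.sum_lt_top]
  simp

theorem energy_le_of_normH_le {Ψ : Pair} {ε : ℝ}
    (h : normH γ U Ψ ≤ ENNReal.ofReal ε) (j : Fin 2) :
    energy γ U j (Ψ j) ≤ ENNReal.ofReal (ε ^ 2) := by
  have h1 : energy γ U j (Ψ j) ≤ ∑ j, energy γ U j (Ψ j) :=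
    Finset.single_le_sum (f := fun j => energy γ U j (Ψ j)) (fun _ _ => zero_le) (Finset.mem_univ j)
  refine h1.trans ?_
  have h2 : (normH γ U Ψ) ^ (2 : ℝ) = ∑ j, energy γ U j (Ψ j) := by
    rw [normH_eq, ← ENNReal.rpow_mul]
    norm_num
  rw [← h2]
  rcases le_total 0 ε with hε | hε
  · rw [ENNReal.ofReal_pow hε, ← ENNReal.rpow_natCast]
    exact ENNReal.rpow_le_rpow h (by norm_num)
  · rw [ENNReal.ofReal_of_nonpos hε] at h
    rw [le_antisymm h zero_le]
    simp

theorem enorm_sq_eq (z : ℂ) : ‖z‖ₑ ^ 2 = ENNReal.ofReal (‖z‖ ^ 2) := by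
  rw [ENNReal.ofReal_pow (norm_nonneg _), ofReal_norm]

theorem energy_eq (hw : ∀ x, 0 ≤ weight γ U j x) (f : ℝ → ℂ) : energy γ U j f
    = ∫⁻ x, ENNReal.ofReal (‖deriv f x‖ ^ 2 + weight γ U j x * ‖f x‖ ^ 2) := by
  refine lintegral_congr fun x => ?_
  rw [enorm_sq_eq, enorm_sq_eq, ← ENNReal.ofReal_mul (hw x),
    ← ENNReal.ofReal_add (by positivity) (mul_nonneg (hw x) (by positivity))]

theorem energy_mono (hw : ∀ x, 0 ≤ weight γ U j x) {f g : ℝ → ℂ}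
    (h1 : ∀ᵐ x, ‖deriv f x‖ ≤ ‖deriv g x‖) (h2 : ∀ x, ‖f x‖ ≤ ‖g x‖) :
    energy γ U j f ≤ energy γ U j g := by
  rw [energy_eq hw, energy_eq hw]
  refine lintegral_mono_ae ?_
  filter_upwards [h1] with x hx
  have := hw x
  have := h2 x
  gcongr

theorem energy_re_le (hw : ∀ x, 0 ≤ weight γ U j x) (hf : H1loc f) :
    energy γ U j (fun x => ((f x).re : ℂ)) ≤ energy γ U j f := by
  refine energy_mono hw ?_ fun x => ?_
  · filter_upwards [hf.ae_deriv_re] with x hx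
    rw [hx, Complex.norm_real]
    exact Complex.abs_re_le_norm _
  · rw [Complex.norm_real]
    exact Complex.abs_re_le_norm _

theorem energy_im_le (hw : ∀ x, 0 ≤ weight γ U j x) (hf : H1loc f) :
    energy γ U j (fun x => ((f x).im : ℂ)) ≤ energy γ U j f := by
  refine energy_mono hw ?_ fun x => ?_
  · filter_upwards [hf.ae_deriv_im] with x hx
    rw [hx, Complex.norm_real]
    exact Complex.abs_im_le_norm _
  · rw [Complex.norm_real]
    exact Complex.abs_im_le_norm _

theorem energy_const_mul (c : Circle) (f : ℝ → ℂ) :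
    energy γ U j (fun x => (c : ℂ) * f x) = energy γ U j f := by
  have hc : ‖(c : ℂ)‖ₑ = 1 := by
    rw [← ofReal_norm, Circle.norm_coe, ENNReal.ofReal_one]
  simp only [energy, deriv_const_mul_field', enorm_mul, hc, one_mul]

theorem energy_neg (f : ℝ → ℂ) : energy γ U j (fun x => -f x) = energy γ U j f := by
  simp [energy, deriv.fun_neg']

/-- Pointwise |a + b|² ≤ 2|a|² + 2|b|². This stands in for the triangle inequality; the factor 2 is
absorbed in later constants. -/
theorem energy_add_le (hw : ∀ x, 0 ≤ weight γ U j x) (hf : H1loc f) (hg : H1loc g)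
    (hwc : Continuous (weight γ U j)) :
    energy γ U j (fun x => f x + g x) ≤ 2 * energy γ U j f + 2 * energy γ U j g := by
  rw [energy_eq hw, energy_eq hw, energy_eq hw]
  have cf := hf.continuous
  have cg := hg.continuous
  have m1 : Measurable fun x =>
      ENNReal.ofReal (‖deriv f x‖ ^ 2 + weight γ U j x * ‖f x‖ ^ 2) :=
    ENNReal.measurable_ofReal.comp
      (((measurable_deriv f).norm.pow_const 2).add
        (Continuous.measurable (by fun_prop)))
  have m2 : Measurable fun x =>
      ENNReal.ofReal (‖deriv g x‖ ^ 2 + weight γ U j x * ‖g x‖ ^ 2) :=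
    ENNReal.measurable_ofReal.comp
      (((measurable_deriv g).norm.pow_const 2).add
        (Continuous.measurable (by fun_prop)))
  rw [← lintegral_const_mul _ m1, ← lintegral_const_mul _ m2,
    ← lintegral_add_left (m1.const_mul 2)]
  refine lintegral_mono_ae ?_
  filter_upwards [hf.ae_differentiableAt, hg.ae_differentiableAt] with x h1 h2
  have h0 := hw x
  rw [← ENNReal.ofReal_ofNat 2, ← ENNReal.ofReal_mul (by norm_num),
    ← ENNReal.ofReal_mul (by norm_num), ← ENNReal.ofReal_add (by positivity) (by positivity)]
  apply ENNReal.ofReal_le_ofReal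
  rw [deriv_fun_add h1 h2]
  have sq : ∀ a b : ℂ, ‖a + b‖ ^ 2 ≤ 2 * ‖a‖ ^ 2 + 2 * ‖b‖ ^ 2 := by
    intro a b
    have := norm_add_le a b
    have h3 := pow_le_pow_left₀ (norm_nonneg _) this 2
    nlinarith [sq_nonneg (‖a‖ - ‖b‖)]
  have s1 := sq (deriv f x) (deriv g x)
  have s2 := mul_le_mul_of_nonneg_left (sq (f x) (g x)) h0
  linarith

/-- The energy as a pair of bounds for Bochner integrals. -/
theorem integrable_of_energy_le (hw : ∀ x, 0 ≤ weight γ U j x) (hwc : Continuous (weight γ U j))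
    (hf : H1loc f) {N : ℝ} (hN0 : 0 ≤ N) (hN : energy γ U j f ≤ ENNReal.ofReal N) :
    (Integrable fun x => ‖deriv f x‖ ^ 2) ∧ (Integrable fun x => weight γ U j x * ‖f x‖ ^ 2) ∧
      ∫ x, ‖deriv f x‖ ^ 2 ≤ N ∧ ∫ x, weight γ U j x * ‖f x‖ ^ 2 ≤ N := by
  have cf := hf.continuous
  rw [energy_eq hw] at hN
  have gen : ∀ k : ℝ → ℝ, AEStronglyMeasurable k volume → (∀ x, 0 ≤ k x) →
      (∀ x, k x ≤ ‖deriv f x‖ ^ 2 + weight γ U j x * ‖f x‖ ^ 2) →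
      Integrable k ∧ ∫ x, k x ≤ N := by
    intro k hk k0 hle
    have h1 : ∫⁻ x, ENNReal.ofReal (k x) ≤ ENNReal.ofReal N :=
      (lintegral_mono fun x => ENNReal.ofReal_le_ofReal (hle x)).trans hN
    have hi : Integrable k := by
      refine ⟨hk, ?_⟩
      rw [hasFiniteIntegral_iff_ofReal (Eventually.of_forall k0)]
      exact h1.trans_lt ENNReal.ofReal_lt_top
    refine ⟨hi, ?_⟩
    rw [← ofReal_integral_eq_lintegral_ofReal hi (Eventually.of_forall k0)] at h1
    exact (ENNReal.ofReal_le_ofReal_iff hN0).1 h1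
  have r1 := gen (fun x => ‖deriv f x‖ ^ 2)
    ((measurable_deriv f).norm.pow_const 2).aestronglyMeasurable (fun x => by positivity)
    fun x => le_add_of_nonneg_right (mul_nonneg (hw x) (by positivity))
  have r2 := gen (fun x => weight γ U j x * ‖f x‖ ^ 2)
    (Continuous.aestronglyMeasurable (by fun_prop))
    (fun x => mul_nonneg (hw x) (by positivity)) fun x => le_add_of_nonneg_left (by positivity)
  exact ⟨r1.1, r2.1, r1.2, r2.2⟩

theorem energy_lt_top (hw : ∀ x, 0 ≤ weight γ U j x)
    (h1 : Integrable fun x => ‖deriv f x‖ ^ 2)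
    (h2 : Integrable fun x => weight γ U j x * ‖f x‖ ^ 2) : energy γ U j f < ∞ := by
  rw [energy_eq hw]
  exact (h1.add h2).lintegral_lt_top

/-- Pointwise control of a function of finite energy by an interval where the weight is bounded
below. -/
theorem norm_sq_le_of_weight (hw : ∀ x, 0 ≤ weight γ U j x) (hwc : Continuous (weight γ U j))
    (hf : H1loc f) {N c y : ℝ} (hN0 : 0 ≤ N) (hN : energy γ U j f ≤ ENNReal.ofReal N) (hc : 0 < c)
    (hcw : ∀ t ∈ Icc y (y + 1), c ≤ weight γ U j t) (x : ℝ) :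
    ‖f x‖ ^ 2 ≤ (2 / c + 2 * (|x - y| + 1)) * N := by
  obtain ⟨i1, i2, b1, b2⟩ := integrable_of_energy_le hw hwc hf hN0 hN
  have cf := hf.continuous
  -- At the minimum point t of |f|² on the unit interval, c|f(t)|² is at most the weighted integral.
  -- The value at x follows from the Hölder estimate started at t.
  obtain ⟨t, ht, hmin⟩ := (isCompact_Icc (a := y) (b := y + 1)).exists_isMinOn
    ⟨y, by simp⟩ (f := fun t => ‖f t‖ ^ 2) (by fun_prop)
  have hcN : c * ‖f t‖ ^ 2 ≤ N := by
    refine le_trans ?_ b2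
    refine le_trans ?_ (setIntegral_le_integral (s := Icc y (y + 1)) i2
      (Eventually.of_forall fun x => mul_nonneg (hw x) (by positivity)))
    have := setIntegral_mono_on (s := Icc y (y + 1)) (μ := volume)
      (f := fun _ => c * ‖f t‖ ^ 2) (g := fun x => weight γ U j x * ‖f x‖ ^ 2)
      continuous_const.integrableOn_Icc i2.integrableOn measurableSet_Icc fun x hx =>
        mul_le_mul (hcw x hx) (hmin hx) (by positivity) (hw x)
    simpa using this
  have h1 : ‖f t‖ ^ 2 ≤ N / c := by
    rw [le_div_iff₀ hc]; linarith
  have h2 := hf.norm_sub_sq_le i1 b1 x t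
  have h3 : |x - t| ≤ |x - y| + 1 := by
    have : |x - t| ≤ |x - y| + |y - t| := abs_sub_le x y t
    have h4 : |y - t| ≤ 1 := by
      rw [abs_sub_comm, abs_of_nonneg (by linarith [ht.1])]
      linarith [ht.2]
    linarith
  have h5 : ‖f x‖ ^ 2 ≤ 2 * ‖f t‖ ^ 2 + 2 * ‖f x - f t‖ ^ 2 := by
    have : ‖f x‖ ≤ ‖f t‖ + ‖f x - f t‖ := by
      simpa using norm_add_le (f t) (f x - f t)
    have h3 := pow_le_pow_left₀ (norm_nonneg _) this 2
    nlinarith [sq_nonneg (‖f t‖ - ‖f x - f t‖)]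
  have h6 := mul_le_mul_of_nonneg_right h3 hN0
  calc ‖f x‖ ^ 2 ≤ 2 * (N / c) + 2 * ((|x - y| + 1) * N) := by linarith
    _ = _ := by ring

/-- Functions of finite energy grow at most linearly. -/
theorem IsDomainWall.exists_growth (hU : IsDomainWall γ U) (hγ : 1 < γ) (j : Fin 2) :
    ∃ K, 0 < K ∧ ∀ f, H1loc f → ∀ η, 0 ≤ η → energy γ U j f ≤ ENNReal.ofReal (η ^ 2) →
      ∀ x, ‖f x‖ ≤ K * η * (1 + |x|) := by
  have hw := hU.weight_nonneg hγ j
  have hwc := hU.continuous_weight j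
  -- Far out on the side where u_j → 0, the weight is close to γ - 1.
  obtain ⟨y, hy⟩ : ∃ y, ∀ t ∈ Icc y (y + 1), (γ - 1) / 2 ≤ weight γ U j t := by
    fin_cases j
    · have : Tendsto (weight γ U 0) atBot (𝓝 ((γ - 1) * (1 - 0 ^ 2))) :=
        ((hU.bot_fst.pow 2).const_sub 1).const_mul _
      obtain ⟨m, hm⟩ := eventually_atBot.1
        (this.eventually_const_le (show (γ - 1) / 2 < _ by linarith))
      exact ⟨m - 1, fun t ht => hm t (by linarith [ht.2])⟩
    · have : Tendsto (weight γ U 1) atTop (𝓝 ((γ - 1) * (1 - 0 ^ 2))) :=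
        ((hU.top_snd.pow 2).const_sub 1).const_mul _
      obtain ⟨m, hm⟩ := eventually_atTop.1
        (this.eventually_const_le (show (γ - 1) / 2 < _ by linarith))
      exact ⟨m, fun t ht => hm t ht.1⟩
  set c := (γ - 1) / 2 with hc
  have hc0 : 0 < c := by rw [hc]; linarith
  set A := 2 / c + 2 * (|y| + 2) with hA
  have hA1 : 1 ≤ A := by
    have : 0 ≤ 2 / c := by positivity
    have := abs_nonneg y
    linarith
  refine ⟨A, by linarith, fun f hf η hη hN x => ?_⟩
  have h1 := norm_sq_le_of_weight hw hwc hf (sq_nonneg η) hN hc0 hy x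
  refine abs_le_of_sq_le_sq' ?_ (by positivity) |>.2
  refine h1.trans ?_
  have h2 : 2 / c + 2 * (|x - y| + 1) ≤ A * (1 + |x|) := by
    have h3 : |x - y| ≤ |x| + |y| := abs_sub x y
    have h4 : 0 ≤ (2 / c + 2 * (|y| + 1)) * |x| := by positivity
    rw [hA]
    nlinarith
  have h5 : 1 ≤ A * (1 + |x|) := by nlinarith [abs_nonneg x]
  -- The true growth is of order the square root of |x|. Squaring a quantity that is at least 1
  -- gives the cruder linear bound without roots.
  have h6 : 2 / c + 2 * (|x - y| + 1) ≤ (A * (1 + |x|)) ^ 2 := by nlinarith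
  calc (2 / c + 2 * (|x - y| + 1)) * η ^ 2 ≤ (A * (1 + |x|)) ^ 2 * η ^ 2 :=
        mul_le_mul_of_nonneg_right h6 (sq_nonneg _)
    _ = _ := by ring

/-- The second component is uniformly controlled by the energy on every interval `[R, ∞)`. -/
theorem IsDomainWall.exists_bound_right (hU : IsDomainWall γ U) (hγ : 1 < γ) (R : ℝ) :
    ∃ K, 0 < K ∧ ∀ f, H1loc f → ∀ η, 0 ≤ η → energy γ U 1 f ≤ ENNReal.ofReal (η ^ 2) →
      ∀ x ≥ R, ‖f x‖ ≤ K * η := by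
  have hw := hU.weight_nonneg hγ 1
  have hwc := hU.continuous_weight 1
  have : Tendsto (weight γ U 1) atTop (𝓝 ((γ - 1) * (1 - 0 ^ 2))) :=
    ((hU.top_snd.pow 2).const_sub 1).const_mul _
  obtain ⟨m, hm⟩ := eventually_atTop.1
    (this.eventually_const_le (show (γ - 1) / 2 < _ by linarith))
  set c := (γ - 1) / 2 with hc
  have hc0 : 0 < c := by rw [hc]; linarith
  set A := 2 / c + 2 * (|R - m| + 1) with hA
  have hA1 : 1 ≤ A := by
    have : 0 ≤ 2 / c := by positivity
    have := abs_nonneg (R - m)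
    linarith
  refine ⟨A, by linarith, fun f hf η hη hN x hx => ?_⟩
  -- The reference interval moves with x once x ≥ m, so its distance to x stays below |R - m| and
  -- the bound does not grow.
  have h1 := norm_sq_le_of_weight hw hwc hf (sq_nonneg η) hN hc0
    (y := max x m) (fun t ht => hm t ((le_max_right x m).trans ht.1)) x
  refine abs_le_of_sq_le_sq' ?_ (by positivity) |>.2
  refine h1.trans ?_
  have h2 : |x - max x m| ≤ |R - m| := by
    rcases le_total x m with h | h
    · rw [max_eq_right h, abs_of_nonpos (by linarith), abs_of_nonpos (by linarith)]
      linarith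
    · rw [max_eq_left h]
      simp
  have h6 : 2 / c + 2 * (|x - max x m| + 1) ≤ A ^ 2 := by nlinarith
  rw [mul_pow]
  exact mul_le_mul_of_nonneg_right h6 (sq_nonneg _)

end

section

/-! ### Pairings with exponentially decaying kernels -/

theorem integrable_exp_neg_abs {κ : ℝ} (hκ : 0 < κ) :
    Integrable fun x : ℝ => Real.exp (-κ * |x|) := by
  rw [← integrableOn_univ, ← Iic_union_Ioi (a := (0 : ℝ))]
  refine IntegrableOn.union ?_ ?_
  · have h := (integrableOn_exp_mul_Iic hκ 0)
    refine h.congr_fun (fun x hx => ?_) measurableSet_Iic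
    simp only
    rw [abs_of_nonpos hx]
    ring_nf
  · refine (exp_neg_integrableOn_Ioi 0 hκ).congr_fun (fun x hx => ?_) measurableSet_Ioi
    simp only
    rw [abs_of_pos hx]

theorem ExpDecay.of_bound {f : ℝ → ℝ} {κ C : ℝ} (hκ : 0 < κ)
    (h : ∀ x, |f x| ≤ C * Real.exp (-κ * |x|)) : ExpDecay f := by
  refine ⟨⟨κ, hκ, C, fun x hx => ?_⟩, ⟨κ, hκ, C, fun x hx => ?_⟩⟩
  · simpa [abs_of_nonneg hx] using h x
  · simpa [abs_of_nonneg hx] using h (-x)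

/-- Half of the exponential rate absorbs the linear factor. -/
theorem ExpDecay.growth_mul {f : ℝ → ℝ} (hf : ExpDecay f) :
    ExpDecay fun x => (1 + |x|) * f x := by
  obtain ⟨κ, hκ, C, hC⟩ := hf.exists_bound
  have hC0 : 0 ≤ C := by simpa using (abs_nonneg _).trans (hC 0)
  refine ExpDecay.of_bound (κ := κ / 2) (C := (1 + 2 / κ) * C) (by positivity) fun x => ?_
  have hx := abs_nonneg x
  have h1 : 1 + |x| ≤ (1 + 2 / κ) * Real.exp (κ / 2 * |x|) := by
    have h2 : κ / 2 * |x| + 1 ≤ Real.exp (κ / 2 * |x|) := Real.add_one_le_exp _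
    have h3 : 1 ≤ Real.exp (κ / 2 * |x|) := Real.one_le_exp (by positivity)
    have h4 : |x| ≤ 2 / κ * Real.exp (κ / 2 * |x|) := by
      calc |x| = 2 / κ * (κ / 2 * |x|) := by field_simp
        _ ≤ 2 / κ * Real.exp (κ / 2 * |x|) := by gcongr; linarith
    linarith
  rw [abs_mul, abs_of_nonneg (by positivity : 0 ≤ 1 + |x|)]
  calc (1 + |x|) * |f x|
      ≤ ((1 + 2 / κ) * Real.exp (κ / 2 * |x|)) * (C * Real.exp (-κ * |x|)) := by
        gcongr
        exact hC x
    _ = (1 + 2 / κ) * C * (Real.exp (κ / 2 * |x|) * Real.exp (-κ * |x|)) := by ring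
    _ = (1 + 2 / κ) * C * Real.exp (-(κ / 2) * |x|) := by
        rw [← Real.exp_add]; ring_nf

theorem ExpDecay.integrable {f : ℝ → ℝ} (hf : ExpDecay f) (hc : Continuous f) :
    Integrable f := by
  obtain ⟨κ, hκ, C, hC⟩ := hf.exists_bound
  exact ((integrable_exp_neg_abs hκ).const_mul C).mono' hc.aestronglyMeasurable
    (Eventually.of_forall hC)

theorem ExpDecay.tendsto {f : ℝ → ℝ} (hf : ExpDecay f) :
    Tendsto f atTop (𝓝 0) ∧ Tendsto f atBot (𝓝 0) := by
  obtain ⟨κ, hκ, C, hC⟩ := hf.exists_bound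
  have h : Tendsto (fun t : ℝ => C * Real.exp (-κ * t)) atTop (𝓝 0) := by
    have := (Real.tendsto_exp_neg_atTop_nhds_zero.comp (tendsto_id.const_mul_atTop hκ)).const_mul C
    simpa [Function.comp_def] using this
  exact ⟨squeeze_zero_norm hC (h.comp tendsto_abs_atTop_atTop),
    squeeze_zero_norm hC (h.comp tendsto_abs_atBot_atTop)⟩

/-- Translates by bounded amounts of an exponentially decaying function are uniformly dominated. -/
theorem ExpDecay.exists_dominating {k : ℝ → ℝ} (hk : ExpDecay k) (A : ℝ) :
    ∃ b : ℝ → ℝ, Integrable b ∧ ∀ a, |a| ≤ A → ∀ x, (1 + |x|) * |k (x - a)| ≤ b x := by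
  obtain ⟨κ, hκ, C, hC⟩ := hk.growth_mul.exists_bound
  have hC0 : 0 ≤ C := by simpa using (abs_nonneg _).trans (hC 0)
  refine ⟨fun x => (1 + A) * (C * Real.exp (κ * A)) * Real.exp (-κ * |x|),
    (integrable_exp_neg_abs hκ).const_mul _, fun a ha x => ?_⟩
  have hA : 0 ≤ A := (abs_nonneg a).trans ha
  have h1 : 1 + |x| ≤ (1 + A) * (1 + |x - a|) := by
    have : |x| ≤ |x - a| + |a| := by simpa using abs_add_le (x - a) a
    nlinarith [abs_nonneg (x - a)]
  have h2 := hC (x - a)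
  rw [abs_mul, abs_of_nonneg (by positivity : 0 ≤ 1 + |x - a|)] at h2
  have h3 : Real.exp (-κ * |x - a|) ≤ Real.exp (κ * A) * Real.exp (-κ * |x|) := by
    rw [← Real.exp_add]
    apply Real.exp_le_exp.2
    have : |x| ≤ |x - a| + |a| := by simpa using abs_add_le (x - a) a
    nlinarith
  calc (1 + |x|) * |k (x - a)| ≤ (1 + A) * (1 + |x - a|) * |k (x - a)| := by gcongr
    _ = (1 + A) * ((1 + |x - a|) * |k (x - a)|) := by ring
    _ ≤ (1 + A) * (C * (Real.exp (κ * A) * Real.exp (-κ * |x|))) := by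
        exact mul_le_mul_of_nonneg_left (h2.trans (mul_le_mul_of_nonneg_left h3 hC0))
          (by positivity)
    _ = _ := by ring

/-- The function `a ↦ ∫ ψ(x) k(x - a) dx`. -/
def pairing (k : ℝ → ℝ) (ψ : ℝ → ℂ) (a : ℝ) : ℂ := ∫ x, ψ x * (k (x - a) : ℂ)

theorem norm_pairing_integrand_le {k : ℝ → ℝ} {ψ : ℝ → ℂ} {K a x b : ℝ}
    (hK : ‖ψ x‖ ≤ K * (1 + |x|)) (hb : (1 + |x|) * |k (x - a)| ≤ b) (hK0 : 0 ≤ K) :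
    ‖ψ x * (k (x - a) : ℂ)‖ ≤ K * b := by
  rw [norm_mul, Complex.norm_real, Real.norm_eq_abs]
  calc ‖ψ x‖ * |k (x - a)| ≤ K * (1 + |x|) * |k (x - a)| := by gcongr
    _ = K * ((1 + |x|) * |k (x - a)|) := by ring
    _ ≤ K * b := by gcongr

theorem nonneg_of_growth {ψ : ℝ → ℂ} {K : ℝ} (hK : ∀ x, ‖ψ x‖ ≤ K * (1 + |x|)) : 0 ≤ K := by
  simpa using (norm_nonneg _).trans (hK 0)

theorem integrable_pairing {k : ℝ → ℝ} (hk : ExpDecay k) (hkc : Continuous k) {ψ : ℝ → ℂ}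
    (hψ : Continuous ψ) {K : ℝ} (hK : ∀ x, ‖ψ x‖ ≤ K * (1 + |x|)) (a : ℝ) :
    Integrable fun x => ψ x * (k (x - a) : ℂ) := by
  obtain ⟨b, hb, H⟩ := hk.exists_dominating |a|
  exact (hb.const_mul K).mono' (Continuous.aestronglyMeasurable (by fun_prop))
    (Eventually.of_forall fun x =>
      norm_pairing_integrand_le (hK x) (H a le_rfl x) (nonneg_of_growth hK))

/-- B depends only on k and A. The function ψ enters linearly through its growth constant, which the
energy controls; this is what makes pairings continuous in ψ. -/
theorem exists_norm_pairing_le {k : ℝ → ℝ} (hk : ExpDecay k) (A : ℝ) :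
    ∃ B, 0 ≤ B ∧ ∀ (ψ : ℝ → ℂ) (K : ℝ), (∀ x, ‖ψ x‖ ≤ K * (1 + |x|)) →
      ∀ a, |a| ≤ A → ‖pairing k ψ a‖ ≤ K * B := by
  obtain ⟨b, hb, H⟩ := hk.exists_dominating A
  refine ⟨|∫ x, b x|, abs_nonneg _, fun ψ K hK a ha => ?_⟩
  have hK0 := nonneg_of_growth hK
  refine (norm_integral_le_of_norm_le (hb.const_mul K) (Eventually.of_forall fun x =>
    norm_pairing_integrand_le (hK x) (H a ha x) hK0)).trans ?_
  rw [integral_const_mul]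
  exact mul_le_mul_of_nonneg_left (le_abs_self _) hK0

theorem continuous_pairing {k : ℝ → ℝ} (hk : ExpDecay k) (hkc : Continuous k) {ψ : ℝ → ℂ}
    (hψ : Continuous ψ) {K : ℝ} (hK : ∀ x, ‖ψ x‖ ≤ K * (1 + |x|)) :
    Continuous (pairing k ψ) := by
  refine continuous_iff_continuousAt.2 fun a => ?_
  obtain ⟨b, hb, H⟩ := hk.exists_dominating (|a| + 1)
  refine continuousAt_of_dominated (bound := fun x => K * b x)
    (Eventually.of_forall fun a => Continuous.aestronglyMeasurable (by fun_prop)) ?_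
    (hb.const_mul K) (Eventually.of_forall fun x => Continuous.continuousAt (by fun_prop))
  filter_upwards [continuous_abs.continuousAt.eventually_lt_const (lt_add_one |a|)] with c hc
  exact Eventually.of_forall fun x =>
    norm_pairing_integrand_le (hK x) (H c hc.le x) (nonneg_of_growth hK)

/-- Differentiation under the integral falls on the kernel, so ψ need only be continuous with linear
growth. -/
theorem hasDerivAt_pairing {k k' : ℝ → ℝ} (hk : ExpDecay k) (hk' : ExpDecay k')
    (hd : ∀ x, HasDerivAt k (k' x) x) (hkc' : Continuous k') {ψ : ℝ → ℂ}
    (hψ : Continuous ψ) {K : ℝ} (hK : ∀ x, ‖ψ x‖ ≤ K * (1 + |x|)) (a : ℝ) :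
    HasDerivAt (pairing k ψ) (-pairing k' ψ a) a := by
  have hkc : Continuous k := continuous_iff_continuousAt.2 fun x => (hd x).continuousAt
  obtain ⟨b, hb, H⟩ := hk'.exists_dominating (|a| + 1)
  have hs : {c : ℝ | |c| < |a| + 1} ∈ 𝓝 a :=
    continuous_abs.continuousAt.eventually_lt_const (lt_add_one |a|)
  have := (hasDerivAt_integral_of_dominated_loc_of_deriv_le (μ := volume) (𝕜 := ℝ)
    (F := fun c x => ψ x * (k (x - c) : ℂ)) (F' := fun c x => -(ψ x * (k' (x - c) : ℂ)))
    (bound := fun x => K * b x) hs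
    (Eventually.of_forall fun a => Continuous.aestronglyMeasurable (by fun_prop))
    (integrable_pairing hk hkc hψ hK a) (Continuous.aestronglyMeasurable (by fun_prop))
    (Eventually.of_forall fun x c hc => ?_) (hb.const_mul K)
    (Eventually.of_forall fun x c _ => ?_)).2
  · rw [integral_neg] at this
    exact this
  · rw [norm_neg]
    exact norm_pairing_integrand_le (hK x) (H c (le_of_lt hc) x) (nonneg_of_growth hK)
  · have h1 : HasDerivAt (fun c => k (x - c)) (-k' (x - c)) c := by
      simpa using (hd (x - c)).comp_const_sub x c
    exact (h1.ofReal_comp.const_mul (ψ x)).congr_deriv (by push_cast; ring)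

theorem pairing_sub {k : ℝ → ℝ} (hk : ExpDecay k) (hkc : Continuous k) {ψ φ : ℝ → ℂ}
    (hψ : Continuous ψ) {K : ℝ} (hK : ∀ x, ‖ψ x‖ ≤ K * (1 + |x|)) (hφ : Continuous φ) {L : ℝ}
    (hL : ∀ x, ‖φ x‖ ≤ L * (1 + |x|)) (a : ℝ) :
    pairing k (fun x => ψ x - φ x) a = pairing k ψ a - pairing k φ a := by
  rw [pairing, pairing, pairing, ← integral_sub (integrable_pairing hk hkc hψ hK a)
    (integrable_pairing hk hkc hφ hL a)]
  simp only [sub_mul]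

theorem pairing_const_mul (k : ℝ → ℝ) (c : ℂ) (ψ : ℝ → ℂ) (a : ℝ) :
    pairing k (fun x => c * ψ x) a = c * pairing k ψ a := by
  simp only [pairing, mul_assoc]
  exact integral_const_mul _ _

theorem pairing_comp_add (k : ℝ → ℝ) (ψ : ℝ → ℂ) (s a : ℝ) :
    pairing k (fun x => ψ (x + s)) a = pairing k ψ (a + s) := by
  rw [pairing, pairing, ← integral_add_right_eq_self (fun x => ψ x * (k (x - (a + s)) : ℂ)) s]
  simp only [add_sub_add_right_eq_sub]

theorem pairing_real (k : ℝ → ℝ) (u : ℝ → ℝ) (a : ℝ) :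
    pairing k (fun x => (u x : ℂ)) a = ((∫ x, u x * k (x - a) : ℝ) : ℂ) := by
  rw [pairing, ← integral_complex_ofReal]
  push_cast
  rfl

theorem pairing_re {k : ℝ → ℝ} (hk : ExpDecay k) (hkc : Continuous k) {ψ : ℝ → ℂ}
    (hψ : Continuous ψ) {K : ℝ} (hK : ∀ x, ‖ψ x‖ ≤ K * (1 + |x|)) (a : ℝ) :
    pairing k (fun x => ((ψ x).re : ℂ)) a = ((pairing k ψ a).re : ℂ) := by
  rw [pairing_real]
  congr 1
  rw [pairing, ← Complex.reCLM_apply, ← ContinuousLinearMap.integral_comp_comm _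
    (integrable_pairing hk hkc hψ hK a)]
  simp

theorem pairing_im {k : ℝ → ℝ} (hk : ExpDecay k) (hkc : Continuous k) {ψ : ℝ → ℂ}
    (hψ : Continuous ψ) {K : ℝ} (hK : ∀ x, ‖ψ x‖ ≤ K * (1 + |x|)) (a : ℝ) :
    pairing k (fun x => ((ψ x).im : ℂ)) a = ((pairing k ψ a).im : ℂ) := by
  rw [pairing_real]
  congr 1
  rw [pairing, ← Complex.imCLM_apply, ← ContinuousLinearMap.integral_comp_comm _
    (integrable_pairing hk hkc hψ hK a)]
  simp

/-- Integrability of `f' k` and integration by parts. -/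
theorem H1loc.integral_deriv_mul {f : ℝ → ℂ} (hf : H1loc f)
    (hi : Integrable fun x => ‖deriv f x‖ ^ 2) {K : ℝ} (hK : ∀ x, ‖f x‖ ≤ K * (1 + |x|))
    {k k' : ℝ → ℝ} (hk : ExpDecay k) (hk' : ExpDecay k') (hd : ∀ x, HasDerivAt k (k' x) x)
    (hkc' : Continuous k') :
    Integrable (fun x => deriv f x * (k x : ℂ)) ∧
      ∫ x, deriv f x * (k x : ℂ) = -∫ x, f x * (k' x : ℂ) := by
  have hkc : Continuous k := continuous_iff_continuousAt.2 fun x => (hd x).continuousAt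
  have hf' := hf.continuous
  -- Both f' and k are square integrable, so |f' k| ≤ |f'|² + k² gives a dominating function.
  have i1 : Integrable (fun x => deriv f x * (k x : ℂ)) := by
    have i2 : Integrable fun x => k x ^ 2 := by
      have h2 := hk.mul_bdd hk.bdd
      simpa [sq] using h2.integrable (by fun_prop)
    refine (hi.add i2).mono' ((aestronglyMeasurable_deriv f volume).mul
      (Continuous.aestronglyMeasurable (by fun_prop))) (Eventually.of_forall fun x => ?_)
    rw [norm_mul, Complex.norm_real, Real.norm_eq_abs]
    simp only [Pi.add_apply]
    rw [← sq_abs (k x)]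
    nlinarith [sq_nonneg (‖deriv f x‖ - |k x|), sq_nonneg ‖deriv f x‖, sq_nonneg |k x|]
  refine ⟨i1, ?_⟩
  have i3 : Integrable fun x => f x * (k' x : ℂ) := by
    simpa using integrable_pairing hk' hkc' hf' hK 0
  have hprod := hf.mul_real hd hkc'
  have hder : ∀ᵐ x, deriv (fun x => f x * (k x : ℂ)) x
      = deriv f x * (k x : ℂ) + f x * (k' x : ℂ) := by
    filter_upwards [hf.ae_differentiableAt] with x hx
    exact (hx.hasDerivAt.mul (hd x).ofReal_comp).deriv
  have hint : Integrable (deriv fun x => f x * (k x : ℂ)) :=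
    (i1.add i3).congr (hder.mono fun x hx => hx.symm)
  have lim1 := intervalIntegral_tendsto_integral hint tendsto_neg_atTop_atBot tendsto_id
  have hz : ∀ x, ‖f x * (k x : ℂ)‖ ≤ K * |(1 + |x|) * k x| := by
    intro x
    rw [norm_mul, Complex.norm_real, Real.norm_eq_abs, abs_mul,
      abs_of_nonneg (by positivity : 0 ≤ 1 + |x|), ← mul_assoc]
    exact mul_le_mul_of_nonneg_right (hK x) (abs_nonneg _)
  have g := hk.growth_mul.tendsto
  -- The boundary terms vanish: linear growth against exponential decay.
  have z1 : Tendsto (fun x => f x * (k x : ℂ)) atTop (𝓝 0) :=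
    squeeze_zero_norm hz (by simpa using g.1.abs.const_mul K)
  have z2 : Tendsto (fun x => f x * (k x : ℂ)) atBot (𝓝 0) :=
    squeeze_zero_norm hz (by simpa using g.2.abs.const_mul K)
  have lim2 : Tendsto (fun x : ℝ => ∫ t in (-x)..x, deriv (fun x => f x * (k x : ℂ)) t) atTop
      (𝓝 (0 - 0)) := by
    refine (z1.sub (z2.comp tendsto_neg_atTop_atBot)).congr fun x => ?_
    rw [hprod.integral_deriv]
    rfl
  have h0 := tendsto_nhds_unique lim1 lim2
  rw [integral_congr_ae hder, integral_add i1 i3, sub_zero] at h0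
  exact eq_neg_of_add_eq_zero_left h0

end

section

/-! ### Kernels representing the inner products with `u_j` and `u_j'` -/

variable {γ : ℝ} {U : RealPair} {j : Fin 2}

/-- `k` is a `C¹` function with derivative `k'`, both decaying exponentially. -/
structure IsKernel (k k' : ℝ → ℝ) : Prop where
  decay : ExpDecay k
  decay' : ExpDecay k'
  hasDerivAt : ∀ x, HasDerivAt k (k' x) x
  continuous' : Continuous k'

theorem IsKernel.continuous {k k' : ℝ → ℝ} (h : IsKernel k k') : Continuous k :=
  continuous_iff_continuousAt.2 fun x => (h.hasDerivAt x).continuousAt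

/-- The third derivative `u_j'''`. -/
def jerk (γ : ℝ) (U : RealPair) (j : Fin 2) (x : ℝ) : ℝ :=
  deriv (U j) x * (3 * U j x ^ 2 + γ * U j.rev x ^ 2 - 1)
    + deriv (U j.rev) x * (2 * γ * (U j x * U j.rev x))

/-- The fourth derivative `u_j''''`. -/
def jerkDeriv (γ : ℝ) (U : RealPair) (j : Fin 2) (x : ℝ) : ℝ :=
  accel γ U j x * (3 * U j x ^ 2 + γ * U j.rev x ^ 2 - 1)
    + deriv (U j) x * (6 * (U j x * deriv (U j) x) + 2 * γ * (U j.rev x * deriv (U j.rev) x))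
    + (accel γ U j.rev x * (2 * γ * (U j x * U j.rev x))
      + deriv (U j.rev) x * (2 * γ * (deriv (U j) x * U j.rev x + U j x * deriv (U j.rev) x)))

theorem IsDomainWall.hasDerivAt_accel (hU : IsDomainWall γ U) (j : Fin 2) (x : ℝ) :
    HasDerivAt (accel γ U j) (jerk γ U j x) x := by
  have h1 := hU.hasDerivAt j x
  have h2 := hU.hasDerivAt j.rev x
  refine ((((h1.pow 2).add ((h2.pow 2).const_mul γ)).sub_const 1).mul h1).congr_deriv ?_
  simp only [jerk, Pi.add_apply, Pi.pow_apply]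
  push_cast
  ring

theorem IsDomainWall.hasDerivAt_jerk (hU : IsDomainWall γ U) (j : Fin 2) (x : ℝ) :
    HasDerivAt (jerk γ U j) (jerkDeriv γ U j x) x := by
  have h1 := hU.hasDerivAt j x
  have h2 := hU.hasDerivAt j.rev x
  have h3 := hU.hasDerivAt_deriv j x
  have h4 := hU.hasDerivAt_deriv j.rev x
  refine ((h3.mul ((((h1.pow 2).const_mul 3).add ((h2.pow 2).const_mul γ)).sub_const 1)).add
    (h4.mul ((h1.mul h2).const_mul (2 * γ)))).congr_deriv ?_
  simp only [jerkDeriv, Pi.add_apply, Pi.pow_apply, Pi.mul_apply]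
  push_cast
  ring

theorem IsDomainWall.continuous_accel (hU : IsDomainWall γ U) (j : Fin 2) :
    Continuous (accel γ U j) :=
  continuous_iff_continuousAt.2 fun x => (hU.hasDerivAt_accel j x).continuousAt

theorem IsDomainWall.continuous_jerk (hU : IsDomainWall γ U) (j : Fin 2) :
    Continuous (jerk γ U j) :=
  continuous_iff_continuousAt.2 fun x => (hU.hasDerivAt_jerk j x).continuousAt

theorem IsDomainWall.continuous_jerkDeriv (hU : IsDomainWall γ U) (j : Fin 2) :
    Continuous (jerkDeriv γ U j) := by
  have h1 := hU.continuous j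
  have h2 := hU.continuous j.rev
  have h3 := hU.continuous_deriv j
  have h4 := hU.continuous_deriv j.rev
  have h5 := hU.continuous_accel j
  have h6 := hU.continuous_accel j.rev
  unfold jerkDeriv
  fun_prop

theorem IsDomainWall.decay_jerk (hU : IsDomainWall γ U) (hγ : 1 < γ) (j : Fin 2) :
    ExpDecay (jerk γ U j) := by
  have b1 := hU.bdd j
  have b2 := hU.bdd j.rev
  exact ((hU.decay_deriv hγ j).mul_bdd ((((Bdd.const 3).mul (b1.pow 2)).add
    ((Bdd.const γ).mul (b2.pow 2))).sub (Bdd.const 1))).add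
      ((hU.decay_deriv hγ j.rev).mul_bdd ((Bdd.const (2 * γ)).mul (b1.mul b2)))

theorem IsDomainWall.decay_jerkDeriv (hU : IsDomainWall γ U) (hγ : 1 < γ) (j : Fin 2) :
    ExpDecay (jerkDeriv γ U j) := by
  have b1 := hU.bdd j
  have b2 := hU.bdd j.rev
  have d1 := hU.decay_deriv hγ j
  have d2 := hU.decay_deriv hγ j.rev
  exact (((hU.decay_accel hγ j).mul_bdd ((((Bdd.const 3).mul (b1.pow 2)).add
    ((Bdd.const γ).mul (b2.pow 2))).sub (Bdd.const 1))).add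
      (d1.mul_bdd (((Bdd.const 6).mul (b1.mul d1.bdd)).add
        ((Bdd.const (2 * γ)).mul (b2.mul d2.bdd))))).add
    (((hU.decay_accel hγ j.rev).mul_bdd ((Bdd.const (2 * γ)).mul (b1.mul b2))).add
      (d2.mul_bdd ((Bdd.const (2 * γ)).mul ((d1.bdd.mul b2).add (b1.mul d2.bdd)))))

theorem IsDomainWall.decay_weight_mul_deriv (hU : IsDomainWall γ U) (hγ : 1 < γ) (j : Fin 2) :
    ExpDecay fun x => weight γ U j x * deriv (U j) x :=
  ((hU.decay_deriv hγ j).mul_bdd (hU.bdd_weight j)).congr fun _ => mul_comm _ _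

/-- The kernel representing the inner product with `u_j`. -/
def kerZ (γ : ℝ) (U : RealPair) (j : Fin 2) (x : ℝ) : ℝ :=
  weight γ U j x * U j x - accel γ U j x

/-- The derivative of `kerZ`. -/
def kerZ' (γ : ℝ) (U : RealPair) (j : Fin 2) (x : ℝ) : ℝ :=
  deriv (U j) x * (-2 * (γ - 1) * U j x) * U j x + weight γ U j x * deriv (U j) x - jerk γ U j x

/-- The kernel representing the inner product with `u_j'`. -/
def kerY (γ : ℝ) (U : RealPair) (j : Fin 2) (x : ℝ) : ℝ :=
  weight γ U j x * deriv (U j) x - jerk γ U j x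

/-- The derivative of `kerY`. -/
def kerY' (γ : ℝ) (U : RealPair) (j : Fin 2) (x : ℝ) : ℝ :=
  deriv (U j) x * (-2 * (γ - 1) * U j x) * deriv (U j) x + weight γ U j x * accel γ U j x
    - jerkDeriv γ U j x

theorem IsDomainWall.isKernel_Z (hU : IsDomainWall γ U) (hγ : 1 < γ) (j : Fin 2) :
    IsKernel (kerZ γ U j) (kerZ' γ U j) where
  decay := (hU.decay_weight_mul hγ j).sub (hU.decay_accel hγ j)
  decay' := ((((hU.decay_deriv hγ j).mul_bdd ((Bdd.const (-2 * (γ - 1))).mul (hU.bdd j))).mul_bdd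
    (hU.bdd j)).add (hU.decay_weight_mul_deriv hγ j)).sub (hU.decay_jerk hγ j)
  hasDerivAt x := ((hU.hasDerivAt_weight j x).mul (hU.hasDerivAt j x)).sub
    (hU.hasDerivAt_accel j x)
  continuous' := by
    have h1 := hU.continuous j
    have h3 := hU.continuous_deriv j
    have h4 := hU.continuous_jerk j
    have h5 := hU.continuous_weight j
    unfold kerZ'
    fun_prop

theorem IsDomainWall.isKernel_Y (hU : IsDomainWall γ U) (hγ : 1 < γ) (j : Fin 2) :
    IsKernel (kerY γ U j) (kerY' γ U j) where
  decay := (hU.decay_weight_mul_deriv hγ j).sub (hU.decay_jerk hγ j)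
  decay' := ((((hU.decay_deriv hγ j).mul_bdd ((Bdd.const (-2 * (γ - 1))).mul (hU.bdd j))).mul_bdd
    (hU.decay_deriv hγ j).bdd).add (((hU.decay_accel hγ j).mul_bdd (hU.bdd_weight j)).congr
      fun _ => mul_comm _ _)).sub (hU.decay_jerkDeriv hγ j)
  hasDerivAt x := ((hU.hasDerivAt_weight j x).mul (hU.hasDerivAt_deriv j x)).sub
    (hU.hasDerivAt_jerk j x)
  continuous' := by
    have h1 := hU.continuous j
    have h3 := hU.continuous_deriv j
    have h4 := hU.continuous_jerkDeriv j
    have h5 := hU.continuous_weight j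
    have h6 := hU.continuous_accel j
    unfold kerY'
    fun_prop

theorem IsDomainWall.isKernel_deriv (hU : IsDomainWall γ U) (hγ : 1 < γ) (j : Fin 2) :
    IsKernel (deriv (U j)) (accel γ U j) where
  decay := hU.decay_deriv hγ j
  decay' := hU.decay_accel hγ j
  hasDerivAt := hU.hasDerivAt_deriv j
  continuous' := hU.continuous_accel j

theorem IsDomainWall.isKernel_accel (hU : IsDomainWall γ U) (hγ : 1 < γ) (j : Fin 2) :
    IsKernel (accel γ U j) (jerk γ U j) where
  decay := hU.decay_accel hγ j
  decay' := hU.decay_jerk hγ j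
  hasDerivAt := hU.hasDerivAt_accel j
  continuous' := hU.continuous_jerk j

/-! ### Components of finite energy: pairings, positivity and stability under modulation -/

/-- One component has finite energy. -/
def FiniteEnergy (γ : ℝ) (U : RealPair) (j : Fin 2) (f : ℝ → ℂ) : Prop :=
  H1loc f ∧ energy γ U j f < ∞

theorem FiniteEnergy.exists_le {f : ℝ → ℂ} (hf : FiniteEnergy γ U j f) :
    ∃ η, 0 ≤ η ∧ energy γ U j f ≤ ENNReal.ofReal (η ^ 2) :=
  ⟨Real.sqrt (energy γ U j f).toReal, Real.sqrt_nonneg _, by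
    rw [Real.sq_sqrt ENNReal.toReal_nonneg, ENNReal.ofReal_toReal hf.2.ne]⟩

theorem FiniteEnergy.exists_growth {f : ℝ → ℂ} (hf : FiniteEnergy γ U j f)
    (hU : IsDomainWall γ U) (hγ : 1 < γ) : ∃ K, ∀ x, ‖f x‖ ≤ K * (1 + |x|) := by
  obtain ⟨K, _, hK⟩ := hU.exists_growth hγ j
  obtain ⟨η, hη, hN⟩ := hf.exists_le
  exact ⟨K * η, hK f hf.1 η hη hN⟩

theorem FiniteEnergy.integrable_deriv_sq {f : ℝ → ℂ} (hf : FiniteEnergy γ U j f)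
    (hU : IsDomainWall γ U) (hγ : 1 < γ) : Integrable fun x => ‖deriv f x‖ ^ 2 := by
  obtain ⟨η, hη, hN⟩ := hf.exists_le
  exact (integrable_of_energy_le (hU.weight_nonneg hγ j) (hU.continuous_weight j) hf.1
    (sq_nonneg η) hN).1

theorem IsDomainWall.finiteEnergy_ofReal (hU : IsDomainWall γ U) (hγ : 1 < γ) {k k' : ℝ → ℝ}
    (hk : ∀ x, HasDerivAt k (k' x) x) (hk'c : Continuous k') (hk' : ExpDecay k') (hb : Bdd k)
    (hwk : ExpDecay fun x => weight γ U j x * k x) :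
    FiniteEnergy γ U j fun x => (k x : ℂ) := by
  have hkc : Continuous k := continuous_iff_continuousAt.2 fun x => (hk x).continuousAt
  have hwc := hU.continuous_weight j
  have hd : deriv (fun x => (k x : ℂ)) = fun x => (k' x : ℂ) :=
    funext fun x => (hk x).ofReal_comp.deriv
  refine ⟨H1loc.of_hasDerivAt hk hk'c, energy_lt_top (hU.weight_nonneg hγ j) ?_ ?_⟩
  · rw [hd]
    simp only [Complex.norm_real, Real.norm_eq_abs, sq_abs]
    simp only [sq]
    exact (hk'.mul_bdd hk'.bdd).integrable (by fun_prop)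
  · simp only [Complex.norm_real, Real.norm_eq_abs, sq_abs]
    simp only [sq, ← mul_assoc]
    exact (hwk.mul_bdd hb).integrable (by fun_prop)

theorem IsDomainWall.finiteEnergy (hU : IsDomainWall γ U) (hγ : 1 < γ) (j : Fin 2) :
    FiniteEnergy γ U j fun x => (U j x : ℂ) :=
  hU.finiteEnergy_ofReal hγ (hU.hasDerivAt j) (hU.continuous_deriv j) (hU.decay_deriv hγ j)
    (hU.bdd j) (hU.decay_weight_mul hγ j)

theorem IsDomainWall.finiteEnergy_deriv (hU : IsDomainWall γ U) (hγ : 1 < γ) (j : Fin 2) :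
    FiniteEnergy γ U j fun x => ((deriv (U j) x : ℝ) : ℂ) :=
  hU.finiteEnergy_ofReal hγ (hU.hasDerivAt_deriv j) (hU.continuous_accel j) (hU.decay_accel hγ j)
    (hU.decay_deriv hγ j).bdd (hU.decay_weight_mul_deriv hγ j)

/-- The inner product with a real function, as a pairing. -/
theorem FiniteEnergy.inner_eq {f : ℝ → ℂ} (hf : FiniteEnergy γ U j f)
    (hU : IsDomainWall γ U) (hγ : 1 < γ) {k k' k'' : ℝ → ℝ} (hk : ∀ x, HasDerivAt k (k' x) x)
    (hk' : IsKernel k' k'') (hwk : ExpDecay fun x => weight γ U j x * k x) :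
    ∫ x, (deriv f x * conj (deriv (fun x => (k x : ℂ)) x)
      + (weight γ U j x : ℂ) * f x * conj (k x : ℂ))
      = pairing (fun x => weight γ U j x * k x - k'' x) f 0 := by
  have hkc : Continuous k := continuous_iff_continuousAt.2 fun x => (hk x).continuousAt
  have hwc := hU.continuous_weight j
  obtain ⟨K, hK⟩ := hf.exists_growth hU hγ
  obtain ⟨i1, e1⟩ := hf.1.integral_deriv_mul (hf.integrable_deriv_sq hU hγ) hK hk'.decay hk'.decay'
    hk'.hasDerivAt hk'.continuous'
  have i2 := integrable_pairing hwk (by fun_prop) hf.1.continuous hK 0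
  have i3 := integrable_pairing hk'.decay' hk'.continuous' hf.1.continuous hK 0
  simp only [sub_zero] at i2 i3
  have hd : deriv (fun x => (k x : ℂ)) = fun x => (k' x : ℂ) :=
    funext fun x => (hk x).ofReal_comp.deriv
  simp only [hd, Complex.conj_ofReal, pairing, sub_zero]
  calc ∫ x, (deriv f x * (k' x : ℂ) + (weight γ U j x : ℂ) * f x * (k x : ℂ))
      = ∫ x, (deriv f x * (k' x : ℂ) + f x * ((weight γ U j x * k x : ℝ) : ℂ)) := by
        congr 1 with x
        push_cast
        ring
    _ = (∫ x, f x * ((weight γ U j x * k x : ℝ) : ℂ)) - ∫ x, f x * (k'' x : ℂ) := by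
        rw [integral_add i1 i2, e1, neg_add_eq_sub]
    _ = _ := by
        rw [← integral_sub i2 i3]
        congr 1 with x
        push_cast
        ring

theorem IsDomainWall.not_const (hU : IsDomainWall γ U) (j : Fin 2) (h : ∀ x, deriv (U j) x = 0) :
    False := by
  have hc : ∀ x, U j x = U j 0 := fun x =>
    is_const_of_deriv_eq_zero (fun x => (hU.hasDerivAt j x).differentiableAt) h x 0
  have hl : ∀ {l : Filter ℝ} [l.NeBot] {c : ℝ}, Tendsto (U j) l (𝓝 c) → c = U j 0 :=
    fun h => tendsto_nhds_unique (h.congr hc) tendsto_const_nhds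
  fin_cases j
  · exact zero_ne_one ((hl hU.bot_fst).trans (hl hU.top_fst).symm)
  · exact one_ne_zero ((hl hU.bot_snd).trans (hl hU.top_snd).symm)

theorem eq_zero_of_integral_eq_zero {a b : ℝ → ℝ} (ha : Continuous a) (hia : Integrable fun x => a x ^ 2)
    (hb : ∀ x, 0 ≤ b x) (hib : Integrable b) (h : ∫ x, (a x ^ 2 + b x) ≤ 0) (x : ℝ) : a x = 0 := by
  rw [integral_add hia hib] at h
  have h1 : 0 ≤ ∫ x, b x := integral_nonneg hb
  have h2 : 0 ≤ ∫ x, a x ^ 2 := integral_nonneg fun x => sq_nonneg _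
  have h3 : ∫ x, a x ^ 2 = 0 := by linarith
  rw [integral_eq_zero_iff_of_nonneg (fun x => sq_nonneg _) hia] at h3
  have h4 := (Continuous.ae_eq_iff_eq volume (ha.pow 2) continuous_zero).1 h3
  exact pow_eq_zero_iff (two_ne_zero) |>.1 (congrFun h4 x)

/-- `⟨k, k⟩` as a pairing. -/
theorem IsDomainWall.pairing_self (hU : IsDomainWall γ U) (hγ : 1 < γ) {k k' k'' : ℝ → ℝ}
    (hk : ∀ x, HasDerivAt k (k' x) x) (hk' : IsKernel k' k'') (hb : Bdd k)
    (hwk : ExpDecay fun x => weight γ U j x * k x) :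
    ∃ T : ℝ, pairing (fun x => weight γ U j x * k x - k'' x) (fun x => (k x : ℂ)) 0 = T ∧
      (T ≤ 0 → ∀ x, k' x = 0) := by
  have hkc : Continuous k := continuous_iff_continuousAt.2 fun x => (hk x).continuousAt
  have hwc := hU.continuous_weight j
  have hkc' := hk'.continuous
  refine ⟨∫ x, (k' x ^ 2 + weight γ U j x * k x * k x), ?_, fun h => ?_⟩
  · rw [← (hU.finiteEnergy_ofReal hγ hk hk'.continuous hk'.decay hb hwk).inner_eq hU hγ hk hk' hwk]
    rw [← integral_complex_ofReal]
    congr 1 with x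
    rw [(hk x).ofReal_comp.deriv, Complex.conj_ofReal, Complex.conj_ofReal]
    push_cast
    ring
  · refine eq_zero_of_integral_eq_zero hkc' ?_ (fun x => ?_) ?_ h
    · simp only [sq]
      exact (hk'.decay.mul_bdd hk'.decay.bdd).integrable (by fun_prop)
    · rw [mul_assoc]
      exact mul_nonneg (hU.weight_nonneg hγ j x) (mul_self_nonneg _)
    · exact (hwk.mul_bdd hb).integrable (by fun_prop)

/-- The pairing is the component energy of u_j; it is positive because u_j has different limits at
the two ends. -/
theorem IsDomainWall.pairing_Z_pos (hU : IsDomainWall γ U) (hγ : 1 < γ) (j : Fin 2) :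
    ∃ T : ℝ, 0 < T ∧ pairing (kerZ γ U j) (fun x => (U j x : ℂ)) 0 = T := by
  obtain ⟨T, h1, h2⟩ := hU.pairing_self hγ (hU.hasDerivAt j) (hU.isKernel_deriv hγ j) (hU.bdd j)
    (hU.decay_weight_mul hγ j)
  exact ⟨T, lt_of_not_ge fun h => hU.not_const j (h2 h), h1⟩

/-- Integration by parts gives -∫ u_j Y_j' = ∫ u_j' Y_j, the component energy of u_j'. Were it not
positive, u_j' would be a constant tending to 0, hence zero. This number is the slope at U of the
equation for the position. -/
theorem IsDomainWall.pairing_Y'_neg (hU : IsDomainWall γ U) (hγ : 1 < γ) (j : Fin 2) :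
    ∃ T : ℝ, 0 < T ∧ -pairing (kerY' γ U j) (fun x => (U j x : ℂ)) 0 = T := by
  obtain ⟨T, h1, h2⟩ := hU.pairing_self (j := j) hγ (hU.hasDerivAt_deriv j)
    (hU.isKernel_accel hγ j) (hU.decay_deriv hγ j).bdd (hU.decay_weight_mul_deriv hγ j)
  refine ⟨T, lt_of_not_ge fun h => hU.not_const j fun x => ?_, ?_⟩
  · have hc : ∀ y, deriv (U j) y = deriv (U j) x := fun y =>
      is_const_of_deriv_eq_zero (fun x => (hU.hasDerivAt_deriv j x).differentiableAt)
        (fun x => (hU.hasDerivAt_deriv j x).deriv.trans (h2 h x)) y x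
    exact tendsto_nhds_unique (tendsto_const_nhds.congr fun y => (hc y).symm)
      (hU.decay_deriv hγ j).tendsto.1
  · have hf := hU.finiteEnergy hγ j
    have hY := hU.isKernel_Y hγ j
    obtain ⟨K, hK⟩ := hf.exists_growth hU hγ
    have := (hf.1.integral_deriv_mul (hf.integrable_deriv_sq hU hγ) hK hY.decay hY.decay'
      hY.hasDerivAt hY.continuous').2
    rw [← h1]
    simp only [pairing, sub_zero]
    rw [← this]
    congr 1 with x
    rw [(hU.hasDerivAt j x).ofReal_comp.deriv]
    rfl

/-- Translations are bounded for the energy. -/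
theorem IsDomainWall.exists_energy_translate_le (hU : IsDomainWall γ U) (hγ : 1 < γ) (j : Fin 2)
    (a : ℝ) : ∃ K, 0 < K ∧ ∀ f, H1loc f → ∀ η, 0 ≤ η → energy γ U j f ≤ ENNReal.ofReal (η ^ 2) →
      energy γ U j (fun x => f (x + a)) ≤ ENNReal.ofReal (K * η ^ 2) := by
  have hw := hU.weight_nonneg hγ j
  have hwc := hU.continuous_weight j
  obtain ⟨G, hG0, hG⟩ := hU.exists_growth hγ j
  have hdw : ExpDecay fun x => deriv (U j) x * (-2 * (γ - 1) * U j x) :=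
    (hU.decay_deriv hγ j).mul_bdd ((Bdd.const _).mul (hU.bdd j))
  obtain ⟨κ, hκ, C, hC⟩ := hdw.exists_bound
  have hC0 : 0 ≤ C := by simpa using (abs_nonneg _).trans (hC 0)
  -- D is the mean value bound for w_j(x - a) - w_j(x): a shift by a costs |a| times the bound of
  -- w_j' over [x - |a|, x + |a|].
  set D : ℝ → ℝ := fun x => C * Real.exp (κ * |a|) * |a| * Real.exp (-κ * |x|) with hD
  have hD0 : ∀ x, 0 ≤ D x := fun x => by positivity
  have hDe : ExpDecay D := ExpDecay.of_bound (C := C * Real.exp (κ * |a|) * |a|) hκ fun x => by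
    rw [abs_of_nonneg (hD0 x)]
  have hwD : ∀ x, weight γ U j (x - a) ≤ weight γ U j x + D x := by
    intro x
    have := (convex_Icc (x - |a|) (x + |a|)).norm_image_sub_le_of_norm_hasDerivWithin_le
      (f := weight γ U j) (C := C * (Real.exp (κ * |a|) * Real.exp (-κ * |x|)))
      (fun y _ => (hU.hasDerivAt_weight j y).hasDerivWithinAt) (fun y hy => ?_)
      (x := x) (y := x - a) ?_ ?_
    · rw [Real.norm_eq_abs, Real.norm_eq_abs, sub_sub_cancel_left, abs_neg] at this
      have := (le_abs_self _).trans this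
      simp only [hD]
      linarith
    · refine (hC y).trans (mul_le_mul_of_nonneg_left ?_ hC0)
      rw [← Real.exp_add]
      apply Real.exp_le_exp.2
      have h1 : |x| ≤ |a| + |y| := by
        have h2 : |x - y| ≤ |a| := abs_le.2 ⟨by linarith [hy.2], by linarith [hy.1]⟩
        have h3 : |x| ≤ |x - y| + |y| := by simpa using abs_add_le (x - y) y
        linarith
      nlinarith
    · constructor <;> linarith [abs_nonneg a]
    · constructor <;> linarith [le_abs_self a, neg_abs_le a]
  -- The correction ∫ D|f|² is finite and of order η²: D decays exponentially and |f| grows at most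
  -- like η(1 + |x|).
  have hDi : Integrable fun x => (1 + |x|) * ((1 + |x|) * D x) :=
    hDe.growth_mul.growth_mul.integrable (by fun_prop)
  set I := ∫ x, (1 + |x|) * ((1 + |x|) * D x) with hI
  have hI0 : 0 ≤ I := integral_nonneg fun x => by have := hD0 x; positivity
  refine ⟨2 + G ^ 2 * I, by positivity, fun f hf η hη hN => ?_⟩
  obtain ⟨i1, i2, b1, b2⟩ := integrable_of_energy_le hw hwc hf (sq_nonneg η) hN
  have hg := hG f hf η hη hN
  have hpt : ∀ x, weight γ U j (x - a) * ‖f x‖ ^ 2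
      ≤ weight γ U j x * ‖f x‖ ^ 2 + G ^ 2 * η ^ 2 * ((1 + |x|) * ((1 + |x|) * D x)) := by
    intro x
    have h1 := mul_le_mul_of_nonneg_right (hwD x) (sq_nonneg ‖f x‖)
    have h2 := mul_le_mul_of_nonneg_left (pow_le_pow_left₀ (norm_nonneg _) (hg x) 2) (hD0 x)
    calc _ ≤ weight γ U j x * ‖f x‖ ^ 2 + D x * ‖f x‖ ^ 2 := by linarith
      _ ≤ weight γ U j x * ‖f x‖ ^ 2 + D x * (G * η * (1 + |x|)) ^ 2 := by linarith
      _ = _ := by ring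
  rw [energy_eq hw, ← lintegral_sub_right_eq_self _ a]
  simp only [deriv_comp_add_const, sub_add_cancel]
  have i4 : Integrable fun x => weight γ U j x * ‖f x‖ ^ 2
      + G ^ 2 * η ^ 2 * ((1 + |x|) * ((1 + |x|) * D x)) := i2.add (hDi.const_mul _)
  have i3 : Integrable fun x => ‖deriv f x‖ ^ 2 +
      (weight γ U j x * ‖f x‖ ^ 2 + G ^ 2 * η ^ 2 * ((1 + |x|) * ((1 + |x|) * D x))) :=
    i1.add i4
  calc _ ≤ ∫⁻ x, ENNReal.ofReal (‖deriv f x‖ ^ 2 +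
      (weight γ U j x * ‖f x‖ ^ 2 + G ^ 2 * η ^ 2 * ((1 + |x|) * ((1 + |x|) * D x)))) :=
        lintegral_mono fun x => ENNReal.ofReal_le_ofReal (by linarith [hpt x])
    _ = ENNReal.ofReal (∫ x, (‖deriv f x‖ ^ 2 +
      (weight γ U j x * ‖f x‖ ^ 2 + G ^ 2 * η ^ 2 * ((1 + |x|) * ((1 + |x|) * D x))))) := by
        rw [ofReal_integral_eq_lintegral_ofReal i3 (Eventually.of_forall fun x => ?_)]
        have := hw x
        have := hD0 x
        simp only [Pi.zero_apply]
        positivity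
    _ ≤ _ := by
        apply ENNReal.ofReal_le_ofReal
        rw [integral_add i1 i4, integral_add i2 (hDi.const_mul _),
          integral_const_mul, ← hI]
        linarith

theorem FiniteEnergy.comp_add_right {f : ℝ → ℂ} (hf : FiniteEnergy γ U j f)
    (hU : IsDomainWall γ U) (hγ : 1 < γ) (a : ℝ) : FiniteEnergy γ U j fun x => f (x + a) := by
  obtain ⟨K, _, hK⟩ := hU.exists_energy_translate_le hγ j a
  obtain ⟨η, hη, hN⟩ := hf.exists_le
  exact ⟨hf.1.comp_add_right a, (hK f hf.1 η hη hN).trans_lt ENNReal.ofReal_lt_top⟩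

theorem FiniteEnergy.add {f g : ℝ → ℂ} (hf : FiniteEnergy γ U j f) (hg : FiniteEnergy γ U j g)
    (hU : IsDomainWall γ U) (hγ : 1 < γ) : FiniteEnergy γ U j fun x => f x + g x := by
  refine ⟨hf.1.add hg.1, (energy_add_le (hU.weight_nonneg hγ j) hf.1 hg.1
    (hU.continuous_weight j)).trans_lt ?_⟩
  exact ENNReal.add_lt_top.2 ⟨ENNReal.mul_lt_top (by simp) hf.2, ENNReal.mul_lt_top (by simp) hg.2⟩

theorem FiniteEnergy.const_mul {f : ℝ → ℂ} (hf : FiniteEnergy γ U j f) (c : Circle) :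
    FiniteEnergy γ U j fun x => (c : ℂ) * f x :=
  ⟨hf.1.const_mul c, by rw [energy_const_mul]; exact hf.2⟩

theorem FiniteEnergy.sub {f g : ℝ → ℂ} (hf : FiniteEnergy γ U j f) (hg : FiniteEnergy γ U j g)
    (hU : IsDomainWall γ U) (hγ : 1 < γ) : FiniteEnergy γ U j fun x => f x - g x := by
  have h : FiniteEnergy γ U j fun x => -g x :=
    ⟨by simpa using hg.1.const_mul (-1), by rw [energy_neg]; exact hg.2⟩
  simpa [sub_eq_add_neg] using hf.add h hU hγ

theorem FiniteEnergy.re {f : ℝ → ℂ} (hf : FiniteEnergy γ U j f)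
    (hU : IsDomainWall γ U) (hγ : 1 < γ) : FiniteEnergy γ U j fun x => ((f x).re : ℂ) :=
  ⟨hf.1.re, (energy_re_le (hU.weight_nonneg hγ j) hf.1).trans_lt hf.2⟩

theorem FiniteEnergy.im {f : ℝ → ℂ} (hf : FiniteEnergy γ U j f)
    (hU : IsDomainWall γ U) (hγ : 1 < γ) : FiniteEnergy γ U j fun x => ((f x).im : ℂ) :=
  ⟨hf.1.im, (energy_im_le (hU.weight_nonneg hγ j) hf.1).trans_lt hf.2⟩

end

section

/-! ### Rigidity and the local modulation equation -/

variable {γ : ℝ} {U : RealPair} {j : Fin 2}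

/-- `Ψ_{a,θ}` is close to `U`, componentwise. -/
def Near (γ : ℝ) (U : RealPair) (η : ℝ) (Ψ : Pair) (a : ℝ) (θ : Fin 2 → Real.Angle) : Prop :=
  ∀ j, energy γ U j (fun x => ((θ j).toCircle : ℂ) * Ψ j (x + a) - (U j x : ℂ))
    ≤ ENNReal.ofReal (η ^ 2)

theorem energy_mono_sq {f : ℝ → ℂ} {ε δ : ℝ} (h : energy γ U j f ≤ ENNReal.ofReal (ε ^ 2))
    (hε : 0 ≤ ε) (hδ : ε ≤ δ) : energy γ U j f ≤ ENNReal.ofReal (δ ^ 2) :=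
  h.trans (ENNReal.ofReal_le_ofReal (pow_le_pow_left₀ hε hδ 2))

theorem Near.mono {ε δ a : ℝ} {Ψ : Pair} {θ : Fin 2 → Real.Angle} (h : Near γ U ε Ψ a θ)
    (hε : 0 ≤ ε) (hδ : ε ≤ δ) : Near γ U δ Ψ a θ :=
  fun j => energy_mono_sq (h j) hε hδ

theorem H1loc.modulate_sub {f : ℝ → ℂ} (hf : H1loc f) (hU : IsDomainWall γ U) (j : Fin 2) (c : ℂ)
    (a : ℝ) : H1loc fun x => c * f (x + a) - (U j x : ℂ) :=
  ((hf.comp_add_right a).const_mul c).sub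
    (H1loc.of_hasDerivAt (hU.hasDerivAt j) (hU.continuous_deriv j))

/-- U itself has finite energy, so adding it to the difference and undoing phase and shift stays in
the space. -/
theorem IsDomainWall.finiteEnergy_of_near (hU : IsDomainWall γ U) (hγ : 1 < γ) {Ψ : Pair}
    (hΨ : ∀ j, H1loc (Ψ j)) {η a : ℝ} {θ : Fin 2 → Real.Angle} (h : Near γ U η Ψ a θ)
    (j : Fin 2) : FiniteEnergy γ U j (Ψ j) := by
  have h1 : FiniteEnergy γ U j (fun x => ((θ j).toCircle : ℂ) * Ψ j (x + a) - (U j x : ℂ)) :=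
    ⟨(hΨ j).modulate_sub hU j _ a, (h j).trans_lt ENNReal.ofReal_lt_top⟩
  have h2 := ((h1.add (hU.finiteEnergy hγ j) hU hγ).const_mul (θ j).toCircle⁻¹).comp_add_right
    hU hγ (-a)
  simpa [← mul_assoc] using h2

/-- If b - a ≥ s, comparing |ψ₂(x + b)| with |u₂(x)| and with |u₂(x + b - a)| shows that |u₂| drops
by at most 2Kε per step of length b - a. A number of steps fixed by s leads from |u₂| > 3/4 to |u₂|
< 1/4, impossible for small ε. Only moduli are compared, so the phases play no role. -/
theorem IsDomainWall.sub_lt_of_near (hU : IsDomainWall γ U) (hγ : 1 < γ) {s : ℝ} (hs : 0 < s) :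
    ∃ ε, 0 < ε ∧ ∀ Ψ : Pair, (∀ j, H1loc (Ψ j)) → ∀ a b θ θ', Near γ U ε Ψ a θ →
      Near γ U ε Ψ b θ' → b - a < s := by
  obtain ⟨y, hy⟩ := (hU.bot_snd.eventually_const_lt (show (3 / 4 : ℝ) < 1 by norm_num)).exists
  obtain ⟨M, hM⟩ := eventually_atTop.1
    (hU.top_snd.abs.eventually_lt_const (show |(0 : ℝ)| < 1 / 4 by norm_num))
  -- n steps of length at least s cross from y to beyond M. With ε = 1/(8K(n + 1)) the total drop is
  -- at most 1/4, whereas it should exceed 1/2.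
  obtain ⟨n, hn⟩ := exists_nat_ge ((M - y) / s)
  rw [div_le_iff₀ hs] at hn
  obtain ⟨K, hK0, hK⟩ := hU.exists_bound_right hγ y
  refine ⟨1 / (8 * K * (n + 1)), by positivity, fun Ψ hΨ a b θ θ' h1 h2 => ?_⟩
  set ε := 1 / (8 * K * ((n : ℝ) + 1)) with hε
  have hε0 : 0 ≤ ε := by positivity
  by_contra! hd
  have gen : ∀ c θ, Near γ U ε Ψ c θ → ∀ x ≥ y, abs (‖Ψ 1 (x + c)‖ - |U 1 x|) ≤ K * ε := by
    intro c θ h x hx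
    have := hK _ ((hΨ 1).modulate_sub hU 1 _ c) ε hε0 (h 1) x hx
    refine le_trans ?_ this
    have h3 := abs_norm_sub_norm_le (((θ 1).toCircle : ℂ) * Ψ 1 (x + c)) (U 1 x : ℂ)
    rwa [norm_mul, Circle.norm_coe, one_mul, Complex.norm_real, Real.norm_eq_abs] at h3
  have step : ∀ x ≥ y, |U 1 x| - |U 1 (x + (b - a))| ≤ 2 * (K * ε) := by
    intro x hx
    have e1 := abs_le.1 (gen b θ' h2 x hx)
    have e2 := abs_le.1 (gen a θ h1 (x + (b - a)) (by linarith))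
    rw [show x + (b - a) + a = x + b by ring] at e2
    linarith [e1.1, e1.2, e2.1, e2.2]
  have iter : ∀ k : ℕ, |U 1 y| - |U 1 (y + k * (b - a))| ≤ k * (2 * (K * ε)) := by
    intro k
    induction k with
    | zero => simp
    | succ k ih =>
      have := step (y + k * (b - a)) (by
        have : 0 ≤ (k : ℝ) * (b - a) := mul_nonneg (Nat.cast_nonneg k) (by linarith)
        linarith)
      push_cast
      rw [show y + ((k : ℝ) + 1) * (b - a) = y + k * (b - a) + (b - a) by ring]
      linarith
  have e1 := iter n
  have e2 := hM (y + n * (b - a)) (by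
    have : (n : ℝ) * s ≤ n * (b - a) := by gcongr
    linarith)
  have e3 : (n : ℝ) * (2 * (K * ε)) ≤ 1 / 4 := by
    have e4 : (n : ℝ) * (2 * (K * ε)) = (n / (n + 1)) * (1 / 4) := by
      rw [hε]
      field_simp
      ring
    rw [e4]
    have : (n : ℝ) / (n + 1) ≤ 1 := by
      rw [div_le_one (by positivity)]
      linarith
    linarith
  linarith [le_abs_self (U 1 y)]

/-- The position of a function close to the orbit of `U` is determined up to a small error. -/
theorem IsDomainWall.abs_sub_lt_of_near (hU : IsDomainWall γ U) (hγ : 1 < γ) {s : ℝ}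
    (hs : 0 < s) : ∃ ε, 0 < ε ∧ ∀ Ψ : Pair, (∀ j, H1loc (Ψ j)) → ∀ a b θ θ', Near γ U ε Ψ a θ →
      Near γ U ε Ψ b θ' → |a - b| < s := by
  obtain ⟨ε, hε, h⟩ := hU.sub_lt_of_near hγ hs
  refine ⟨ε, hε, fun Ψ hΨ a b θ θ' h1 h2 => abs_lt.2 ⟨?_, ?_⟩⟩
  · linarith [h Ψ hΨ a b θ θ' h1 h2]
  · exact h Ψ hΨ b a θ' θ h2 h1

/-- Joint continuity of `pairing k ψ a` in `ψ` and `a`. -/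
theorem IsDomainWall.pairing_near (hU : IsDomainWall γ U) (hγ : 1 < γ) {k : ℝ → ℝ}
    (hk : ExpDecay k) (hkc : Continuous k) {ψ : ℝ → ℂ} (hψ : FiniteEnergy γ U j ψ) (a : ℝ) {r : ℝ}
    (hr : 0 < r) : ∃ s, 0 < s ∧ ∀ φ, FiniteEnergy γ U j φ →
      energy γ U j (fun x => φ x - ψ x) ≤ ENNReal.ofReal (s ^ 2) → ∀ b, |b - a| ≤ s →
      ‖pairing k φ b - pairing k ψ a‖ < r := by
  obtain ⟨K, hK⟩ := hψ.exists_growth hU hγ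
  obtain ⟨B, hB0, hB⟩ := exists_norm_pairing_le hk (|a| + 1)
  obtain ⟨G, hG0, hG⟩ := hU.exists_growth hγ j
  have hcont : ContinuousAt (pairing k ψ) a :=
    (continuous_pairing hk hkc hψ.1.continuous hK).continuousAt
  obtain ⟨d, hd, hdc⟩ := Metric.continuousAt_iff.1 hcont (r / 2) (half_pos hr)
  -- In turn: |b - a| < d for continuity in the shift, |b| ≤ |a| + 1 for the uniform bound B, and G
  -- s B ≤ r/4 for the change of function.
  refine ⟨min (d / 2) (min 1 (r / (4 * (G * B + 1)))), by positivity, fun φ hφ hN b hb => ?_⟩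
  set s := min (d / 2) (min 1 (r / (4 * (G * B + 1)))) with hs
  have hs0 : 0 < s := by positivity
  have s1 : s ≤ d / 2 := min_le_left _ _
  have s2 : s ≤ 1 := (min_le_right _ _).trans (min_le_left _ _)
  have s3 : s ≤ r / (4 * (G * B + 1)) := (min_le_right _ _).trans (min_le_right _ _)
  obtain ⟨L, hL⟩ := hφ.exists_growth hU hγ
  have h1 := hB _ (G * s) (hG _ (hφ.1.sub hψ.1) s hs0.le hN) b (by
    have : |b| ≤ |b - a| + |a| := by simpa using abs_add_le (b - a) a
    linarith)
  rw [pairing_sub hk hkc hφ.1.continuous hL hψ.1.continuous hK] at h1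
  have h2 : dist (pairing k ψ b) (pairing k ψ a) < r / 2 := hdc (by
    rw [Real.dist_eq]; linarith)
  rw [dist_eq_norm] at h2
  have h3 : G * s * B ≤ r / 4 := by
    rw [le_div_iff₀ (by positivity)] at s3
    nlinarith [mul_nonneg hG0.le hB0]
  calc ‖pairing k φ b - pairing k ψ a‖
      = ‖(pairing k φ b - pairing k ψ b) + (pairing k ψ b - pairing k ψ a)‖ := by ring_nf
    _ ≤ _ := norm_add_le _ _
    _ < r := by linarith

/-! ### The phase-free equation for the position -/

/-- The component of `y` in the direction of `z`. -/
def along (z y : ℂ) : ℝ := (conj z * y).re / ‖z‖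

/-- The derivative of `along` along a curve with velocity `(z', y')`. -/
def alongDeriv (z y z' y' : ℂ) : ℝ :=
  (conj z' * y + conj z * y').re / ‖z‖ - (conj z * y).re * (conj z * z').re / ‖z‖ ^ 3

/-- Invariance under a common rotation is what eliminates the phases from the equation for the
position. -/
theorem along_mul (c : Circle) (z y : ℂ) : along (c * z) (c * y) = along z y := by
  have h : conj (c : ℂ) * c = 1 := by
    rw [mul_comm, Complex.mul_conj, Complex.normSq_eq_norm_sq, Circle.norm_coe]
    simp
  rw [along, along, norm_mul, Circle.norm_coe, one_mul, map_mul,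
    show conj (c : ℂ) * conj z * (c * y) = conj (c : ℂ) * c * (conj z * y) by ring, h, one_mul]

theorem along_ofReal {t : ℝ} (ht : 0 < t) (y : ℂ) : along t y = y.re := by
  rw [along, Complex.conj_ofReal, Complex.re_ofReal_mul, Complex.norm_real, Real.norm_eq_abs,
    abs_of_pos ht]
  field_simp

/-- On real data with positive first entry, `along` is just y, so the rotation of z contributes
nothing to the derivative at U. -/
theorem alongDeriv_ofReal {t : ℝ} (ht : 0 < t) (c z s : ℝ) : alongDeriv t c z s = s := by
  simp only [alongDeriv, Complex.conj_ofReal, ← Complex.ofReal_mul, ← Complex.ofReal_add,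
    Complex.ofReal_re, Complex.norm_real, Real.norm_eq_abs, abs_of_pos ht]
  field_simp
  ring

theorem hasDerivAt_along {z y : ℝ → ℂ} {z' y' : ℂ} {t : ℝ} (hz : HasDerivAt z z' t)
    (hy : HasDerivAt y y' t) (h0 : z t ≠ 0) :
    HasDerivAt (fun t => along (z t) (y t)) (alongDeriv (z t) (y t) z' y') t := by
  have a1 := hasDerivAt_re hz
  have a2 := hasDerivAt_im hz
  have b1 := hasDerivAt_re hy
  have b2 := hasDerivAt_im hy
  have hn : ∀ w : ℂ, ‖w‖ = Real.sqrt (w.re * w.re + w.im * w.im) := fun w => by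
    rw [← Complex.normSq_apply, Complex.normSq_eq_norm_sq, Real.sqrt_sq (norm_nonneg _)]
  have hpos : 0 < ‖z t‖ := norm_pos_iff.2 h0
  have hne : (z t).re * (z t).re + (z t).im * (z t).im ≠ 0 := by
    rw [← Complex.normSq_apply]
    exact Complex.normSq_pos.2 h0 |>.ne'
  have hs := ((a1.mul a1).add (a2.mul a2)).sqrt hne
  have hnum := (a1.mul b1).add (a2.mul b2)
  have hsne : Real.sqrt ((z t).re * (z t).re + (z t).im * (z t).im) ≠ 0 := by
    rw [← hn]; exact hpos.ne'
  have key := hnum.div hs hsne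
  have e : (fun t => along (z t) (y t)) = fun t => ((z t).re * (y t).re + (z t).im * (y t).im)
      / Real.sqrt ((z t).re * (z t).re + (z t).im * (z t).im) := by
    funext t
    rw [along, hn]
    simp
  rw [e]
  refine key.congr_deriv ?_
  simp only [alongDeriv, Pi.add_apply, Pi.mul_apply, ← hn]
  simp only [Complex.add_re, Complex.mul_re, Complex.conj_re, Complex.conj_im]
  field_simp
  ring

theorem continuousAt_along {p : ℂ × ℂ} (h : p.1 ≠ 0) :
    ContinuousAt (fun p : ℂ × ℂ => along p.1 p.2) p := by
  unfold along
  refine ContinuousAt.div ?_ ?_ (norm_ne_zero_iff.2 h)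
  · exact (Complex.continuous_re.comp
      ((Complex.continuous_conj.comp continuous_fst).mul continuous_snd)).continuousAt
  · fun_prop

theorem continuousAt_alongDeriv {p : ℂ × ℂ × ℂ × ℂ} (h : p.1 ≠ 0) :
    ContinuousAt (fun p : ℂ × ℂ × ℂ × ℂ => alongDeriv p.1 p.2.1 p.2.2.1 p.2.2.2) p := by
  have hc := Complex.continuous_conj
  have hr := Complex.continuous_re
  unfold alongDeriv
  refine ContinuousAt.sub (ContinuousAt.div ?_ ?_ (norm_ne_zero_iff.2 h))
    (ContinuousAt.div ?_ ?_ (pow_ne_zero _ (norm_ne_zero_iff.2 h)))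
  · exact Continuous.continuousAt (by fun_prop)
  · exact Continuous.continuousAt (by fun_prop)
  · exact Continuous.continuousAt (by fun_prop)
  · exact Continuous.continuousAt (by fun_prop)

/-- The contribution of one component to the modulation equation for the position. -/
def posFun (γ : ℝ) (U : RealPair) (j : Fin 2) (ψ : ℝ → ℂ) (a : ℝ) : ℝ :=
  along (pairing (kerZ γ U j) ψ a) (pairing (kerY γ U j) ψ a)

theorem posFun_modulate (c : Circle) (ψ : ℝ → ℂ) (s a : ℝ) :
    posFun γ U j (fun x => (c : ℂ) * ψ (x + s)) a = posFun γ U j ψ (a + s) := by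
  simp only [posFun, pairing_const_mul, along_mul]
  rw [pairing_comp_add, pairing_comp_add]

theorem IsDomainWall.posFun_near (hU : IsDomainWall γ U) (hγ : 1 < γ) {ψ : ℝ → ℂ}
    (hψ : FiniteEnergy γ U j ψ) {a : ℝ} (h0 : pairing (kerZ γ U j) ψ a ≠ 0) {r : ℝ}
    (hr : 0 < r) : ∃ s, 0 < s ∧ ∀ φ, FiniteEnergy γ U j φ →
      energy γ U j (fun x => φ x - ψ x) ≤ ENNReal.ofReal (s ^ 2) →
      |posFun γ U j φ a - posFun γ U j ψ a| < r := by
  have hZ := hU.isKernel_Z hγ j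
  have hY := hU.isKernel_Y hγ j
  obtain ⟨d, hd, H⟩ := Metric.continuousAt_iff.1 (continuousAt_along
    (p := (pairing (kerZ γ U j) ψ a, pairing (kerY γ U j) ψ a)) h0) r hr
  obtain ⟨s1, hs1, H1⟩ := hU.pairing_near hγ hZ.decay hZ.continuous hψ a hd
  obtain ⟨s2, hs2, H2⟩ := hU.pairing_near hγ hY.decay hY.continuous hψ a hd
  refine ⟨min s1 s2, by positivity, fun φ hφ hN => ?_⟩
  have m : (0 : ℝ) ≤ min s1 s2 := by positivity
  have e1 := H1 φ hφ (energy_mono_sq hN m (min_le_left _ _)) a (by simpa using hs1.le)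
  have e2 := H2 φ hφ (energy_mono_sq hN m (min_le_right _ _)) a (by simpa using hs2.le)
  exact H (x := (pairing (kerZ γ U j) φ a, pairing (kerY γ U j) φ a)) (by
    rw [Prod.dist_eq, max_lt_iff, dist_eq_norm, dist_eq_norm]
    exact ⟨e1, e2⟩)

/-- Near `U`, the modulation equation has a positive derivative. -/
theorem IsDomainWall.exists_posFun_deriv (hU : IsDomainWall γ U) (hγ : 1 < γ) (j : Fin 2) :
    ∃ s, 0 < s ∧ ∃ κ, 0 < κ ∧ ∀ φ, FiniteEnergy γ U j φ →
      energy γ U j (fun x => φ x - (U j x : ℂ)) ≤ ENNReal.ofReal (s ^ 2) → ∀ b, |b| ≤ s →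
      pairing (kerZ γ U j) φ b ≠ 0 ∧ ∃ D, κ ≤ D ∧ HasDerivAt (posFun γ U j φ) D b := by
  have hZ := hU.isKernel_Z hγ j
  have hY := hU.isKernel_Y hγ j
  obtain ⟨T, hT, eT⟩ := hU.pairing_Z_pos hγ j
  obtain ⟨S, hS, eS⟩ := hU.pairing_Y'_neg hγ j
  have hfu : FiniteEnergy γ U j fun x => (U j x : ℂ) := hU.finiteEnergy hγ j
  obtain ⟨p, hp⟩ : ∃ p : ℂ × ℂ × ℂ × ℂ, p = (pairing (kerZ γ U j) (fun x => (U j x : ℂ)) 0,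
    pairing (kerY γ U j) (fun x => (U j x : ℂ)) 0, -pairing (kerZ' γ U j) (fun x => (U j x : ℂ)) 0,
    -pairing (kerY' γ U j) (fun x => (U j x : ℂ)) 0) := ⟨_, rfl⟩
  have hT0 : (T : ℂ) ≠ 0 := by exact_mod_cast hT.ne'
  have hval : alongDeriv p.1 p.2.1 p.2.2.1 p.2.2.2 = S := by
    rw [hp]
    dsimp only
    rw [eT, eS, pairing_real (kerY γ U j), pairing_real (kerZ' γ U j), ← Complex.ofReal_neg]
    exact alongDeriv_ofReal hT _ _ _
  obtain ⟨d, hd, H⟩ := Metric.continuousAt_iff.1 (continuousAt_alongDeriv (p := p) (by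
    rw [hp]
    dsimp only
    rwa [eT])) (S / 2) (half_pos hS)
  -- Tolerance T: staying at distance less than T from the value T > 0 excludes 0.
  obtain ⟨s0, hs0, H0⟩ := hU.pairing_near hγ hZ.decay hZ.continuous hfu 0 hT
  obtain ⟨s1, hs1, H1⟩ := hU.pairing_near hγ hZ.decay hZ.continuous hfu 0 hd
  obtain ⟨s2, hs2, H2⟩ := hU.pairing_near hγ hY.decay hY.continuous hfu 0 hd
  obtain ⟨s3, hs3, H3⟩ := hU.pairing_near hγ hZ.decay' hZ.continuous' hfu 0 hd
  obtain ⟨s4, hs4, H4⟩ := hU.pairing_near hγ hY.decay' hY.continuous' hfu 0 hd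
  obtain ⟨s, hs, l0, l1, l2, l3, l4⟩ : ∃ s, 0 < s ∧ s ≤ s0 ∧ s ≤ s1 ∧ s ≤ s2 ∧ s ≤ s3 ∧ s ≤ s4 :=
    ⟨min s0 (min s1 (min s2 (min s3 s4))), by positivity, by simp, by simp, by simp, by simp,
      by simp⟩
  refine ⟨s, hs, S / 2, half_pos hS, fun φ hφ hN b hb => ?_⟩
  obtain ⟨L, hL⟩ := hφ.exists_growth hU hγ
  have hb' : |b - 0| ≤ s := by simpa using hb
  have hz : pairing (kerZ γ U j) φ b ≠ 0 := by
    intro h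
    have := H0 φ hφ (energy_mono_sq hN hs.le l0) b (hb'.trans l0)
    rw [h, zero_sub, norm_neg, eT, Complex.norm_real, Real.norm_eq_abs, abs_of_pos hT] at this
    exact lt_irrefl _ this
  refine ⟨hz, _, ?_, hasDerivAt_along
    (hasDerivAt_pairing hZ.decay hZ.decay' hZ.hasDerivAt hZ.continuous' hφ.1.continuous hL b)
    (hasDerivAt_pairing hY.decay hY.decay' hY.hasDerivAt hY.continuous' hφ.1.continuous hL b) hz⟩
  have := H (x := (pairing (kerZ γ U j) φ b, pairing (kerY γ U j) φ b,
    -pairing (kerZ' γ U j) φ b, -pairing (kerY' γ U j) φ b)) (by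
      rw [hp]
      simp only [Prod.dist_eq, max_lt_iff, dist_neg_neg]
      simp only [dist_eq_norm]
      exact ⟨H1 φ hφ (energy_mono_sq hN hs.le l1) b (hb'.trans l1),
        H2 φ hφ (energy_mono_sq hN hs.le l2) b (hb'.trans l2),
        H3 φ hφ (energy_mono_sq hN hs.le l3) b (hb'.trans l3),
        H4 φ hφ (energy_mono_sq hN hs.le l4) b (hb'.trans l4)⟩)
  rw [hval, Real.dist_eq] at this
  linarith [(abs_lt.1 this).1]

/-- The value at `U` of the modulation equation. -/
def posConst (γ : ℝ) (U : RealPair) : ℝ :=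
  ∑ j, (pairing (kerY γ U j) (fun x => (U j x : ℂ)) 0).re

/-- The modulation equation for the position is uniquely solvable near `U`. -/
theorem IsDomainWall.exists_local (hU : IsDomainWall γ U) (hγ : 1 < γ) :
    ∃ s, 0 < s ∧ ∃ κ, 0 < κ ∧ ∃ ε, 0 < ε ∧ ∀ Ψ : Pair, (∀ j, H1loc (Ψ j)) →
      ∀ a θ, Near γ U ε Ψ a θ →
      (∀ b, |b - a| ≤ s → ∀ j, pairing (kerZ γ U j) (Ψ j) b ≠ 0) ∧
      (∀ b c, |b - a| ≤ s → |c - a| ≤ s → κ * |c - b| ≤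
        |∑ j, posFun γ U j (Ψ j) c - ∑ j, posFun γ U j (Ψ j) b|) ∧
      ∃ b, |b - a| ≤ s / 4 ∧ ∑ j, posFun γ U j (Ψ j) b = posConst γ U := by
  obtain ⟨s0, hs0, κ0, hκ0, H0⟩ := hU.exists_posFun_deriv hγ 0
  obtain ⟨s1, hs1, κ1, hκ1, H1⟩ := hU.exists_posFun_deriv hγ 1
  set s := min s0 s1 with hs
  have hspos : 0 < s := by positivity
  set κ := κ0 + κ1 with hκ
  have hκpos : 0 < κ := by positivity
  have hne : ∀ j, pairing (kerZ γ U j) (fun x => (U j x : ℂ)) 0 ≠ 0 := fun j => by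
    obtain ⟨T, hT, e⟩ := hU.pairing_Z_pos hγ j
    rw [e]
    exact_mod_cast hT.ne'
  have hval : ∀ j, posFun γ U j (fun x => (U j x : ℂ)) 0
      = (pairing (kerY γ U j) (fun x => (U j x : ℂ)) 0).re := fun j => by
    obtain ⟨T, hT, e⟩ := hU.pairing_Z_pos hγ j
    rw [posFun, e, along_ofReal hT]
  -- Two errors of κ(s/4)/2 add up to less than κ s/4, which a slope of at least κ compensates
  -- within s/4 of the centre.
  obtain ⟨t0, ht0, N0⟩ := hU.posFun_near hγ (hU.finiteEnergy hγ 0) (hne 0)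
    (show 0 < κ * (s / 4) / 2 by positivity)
  obtain ⟨t1, ht1, N1⟩ := hU.posFun_near hγ (hU.finiteEnergy hγ 1) (hne 1)
    (show 0 < κ * (s / 4) / 2 by positivity)
  obtain ⟨ε, hε, l0, l1, l2, l3⟩ : ∃ ε, 0 < ε ∧ ε ≤ s0 ∧ ε ≤ s1 ∧ ε ≤ t0 ∧ ε ≤ t1 :=
    ⟨min s0 (min s1 (min t0 t1)), by positivity, by simp, by simp, by simp, by simp⟩
  refine ⟨s, hspos, κ, hκpos, ε, hε, fun Ψ hΨ a θ hN => ?_⟩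
  have hfe := hU.finiteEnergy_of_near hγ hΨ hN
  set Φ : Pair := fun j x => ((θ j).toCircle : ℂ) * Ψ j (x + a) with hΦ
  have hfΦ : ∀ j, FiniteEnergy γ U j (Φ j) := fun j =>
    ((hfe j).comp_add_right hU hγ a).const_mul _
  set F : ℝ → ℝ := fun b => ∑ j, posFun γ U j (Φ j) b with hF
  have hFΨ : ∀ b, ∑ j, posFun γ U j (Ψ j) b = F (b - a) := fun b => by
    simp only [hF, hΦ, posFun_modulate, sub_add_cancel]
  have D : ∀ b, |b| ≤ s → (∀ j, pairing (kerZ γ U j) (Φ j) b ≠ 0) ∧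
      ∃ D, κ ≤ D ∧ HasDerivAt F D b := by
    intro b hb
    obtain ⟨n0, D0, k0, d0⟩ := H0 (Φ 0) (hfΦ 0) (energy_mono_sq (hN 0) hε.le l0) b
      (hb.trans (min_le_left _ _))
    obtain ⟨n1, D1, k1, d1⟩ := H1 (Φ 1) (hfΦ 1) (energy_mono_sq (hN 1) hε.le l1) b
      (hb.trans (min_le_right _ _))
    refine ⟨fun j => by fin_cases j <;> assumption, D0 + D1, add_le_add k0 k1, ?_⟩
    simp only [hF, Fin.sum_univ_two]
    exact d0.add d1
  choose! D1 hD1 using fun b hb => (D b hb).2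
  have incr : ∀ b c, |b| ≤ s → |c| ≤ s → b ≤ c → κ * (c - b) ≤ F c - F b := by
    intro b c hb hc hbc
    refine (convex_Icc (-s) s).mul_sub_le_image_sub_of_le_deriv
      (fun x hx => (hD1 x (abs_le.2 hx)).2.continuousAt.continuousWithinAt)
      (fun x hx => (hD1 x (abs_le.2 (mem_Icc.1 (interior_subset hx)))).2.differentiableAt.differentiableWithinAt)
      (fun x hx => ?_) b (abs_le.1 hb) c (abs_le.1 hc) hbc
    have := hD1 x (abs_le.2 (mem_Icc.1 (interior_subset hx)))
    rw [this.2.deriv]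
    exact this.1
  refine ⟨fun b hb j h => ?_, fun b c hb hc => ?_, ?_⟩
  · refine (D (b - a) hb).1 j ?_
    simp only [hΦ, pairing_const_mul]
    rw [pairing_comp_add, sub_add_cancel, h, mul_zero]
  · rw [hFΨ, hFΨ]
    rcases le_total b c with h | h
    · have := incr (b - a) (c - a) hb hc (by linarith)
      rw [abs_of_nonneg (by linarith : 0 ≤ c - b)]
      rw [show c - a - (b - a) = c - b by ring] at this
      exact this.trans (le_abs_self _)
    · have := incr (c - a) (b - a) hc hb (by linarith)
      rw [abs_sub_comm, abs_of_nonneg (by linarith : 0 ≤ b - c), abs_sub_comm]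
      rw [show b - a - (c - a) = b - c by ring] at this
      exact this.trans (le_abs_self _)
  · have b0 := N0 (Φ 0) (hfΦ 0) (energy_mono_sq (hN 0) hε.le l2)
    have b1 := N1 (Φ 1) (hfΦ 1) (energy_mono_sq (hN 1) hε.le l3)
    rw [hval] at b0 b1
    have hF0 : |F 0 - posConst γ U| < κ * (s / 4) := by
      simp only [hF, posConst, Fin.sum_univ_two]
      rw [abs_lt] at *
      constructor <;> linarith [b0.1, b0.2, b1.1, b1.2]
    rw [abs_lt] at hF0
    have s4 : |s / 4| ≤ s := by rw [abs_of_pos (by positivity)]; linarith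
    have s4' : |-(s / 4)| ≤ s := by rwa [abs_neg]
    have u1 := incr 0 (s / 4) (by simpa using hspos.le) s4 (by positivity)
    have u2 := incr (-(s / 4)) 0 s4' (by simpa using hspos.le) (by linarith)
    have hcont : ContinuousOn F (Icc (-(s / 4)) (s / 4)) := fun x hx =>
      (hD1 x (by rw [abs_le]; constructor <;> linarith [hx.1, hx.2])).2.continuousAt.continuousWithinAt
    -- The root is kept within s/4, although monotonicity holds up to s, to leave room for comparing
    -- the windows of two functions.
    obtain ⟨x, hx, e⟩ := intermediate_value_Icc (by linarith) hcont
      (show posConst γ U ∈ Icc (F (-(s / 4))) (F (s / 4)) from ⟨by linarith, by linarith⟩)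
    refine ⟨x + a, by simpa using abs_le.2 hx, ?_⟩
    rw [hFΨ, add_sub_cancel_right, e]

end

section

/-! ### The decomposition -/

variable {γ : ℝ} {U : RealPair} {j : Fin 2}

theorem toCircle_neg_arg_mul (z : ℂ) :
    ((-(Complex.arg z : Real.Angle)).toCircle : ℂ) * z = (‖z‖ : ℂ) := by
  have h : (((Complex.arg z : Real.Angle).toCircle : Circle) : ℂ) * (‖z‖ : ℂ) = z := by
    rw [Real.Angle.toCircle_coe, Circle.coe_exp, mul_comm]
    exact Complex.norm_mul_exp_arg_mul_I z
  rw [Real.Angle.toCircle_neg]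
  nth_rewrite 2 [← h]
  rw [← mul_assoc, ← Circle.coe_mul, inv_mul_cancel, Circle.coe_one, one_mul]

theorem FiniteEnergy.zero : FiniteEnergy γ U j 0 := by
  constructor
  · simpa using! H1loc.of_hasDerivAt (u := fun _ => 0) (u' := fun _ => 0)
      (fun x => hasDerivAt_const x 0) continuous_const
  · simp [energy, Pi.zero_def]

theorem memH_of_finiteEnergy {Ψ : Pair} (h : ∀ j, FiniteEnergy γ U j (Ψ j)) : MemH γ U Ψ :=
  ⟨fun j => (h j).1, (normH_lt_top_iff γ U Ψ).2 fun j => (h j).2⟩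

/-- The phases annihilating the inner products of `W` with `U₁` and `U₂`. -/
def phase (γ : ℝ) (U : RealPair) (Ψ : Pair) (α : ℝ) (j : Fin 2) : Real.Angle :=
  -(Complex.arg (pairing (kerZ γ U j) (Ψ j) α) : Real.Angle)

theorem pairing_modulate (k : ℝ → ℝ) (Ψ : Pair) (α : ℝ) (θ : Fin 2 → Real.Angle) (j : Fin 2) :
    pairing k (modulate α θ Ψ j) 0 = ((θ j).toCircle : ℂ) * pairing k (Ψ j) α := by
  unfold modulate
  rw [pairing_const_mul, pairing_comp_add, zero_add]

/-- V and W are the real part minus U and the imaginary part of the modulated pair. The phase makes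
each Z-pairing positive real, so its imaginary part ⟨W, U_k⟩ vanishes. The Y-pairings then sum to
⟨V, ∂_x U⟩ = Σ posFun - posConst = 0. -/
theorem IsDomainWall.exists_decomposition (hU : IsDomainWall γ U) (hγ : 1 < γ) {Ψ : Pair}
    (hΨ : ∀ j, FiniteEnergy γ U j (Ψ j)) {α : ℝ}
    (h0 : ∀ j, pairing (kerZ γ U j) (Ψ j) α ≠ 0)
    (hpos : ∑ j, posFun γ U j (Ψ j) α = posConst γ U) :
    ∃ V W : RealPair,
      (∀ j x, modulate α (phase γ U Ψ α) Ψ j x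
        = (U j x : ℂ) + (V j x : ℂ) + Complex.I * (W j x : ℂ)) ∧
      OrthH γ U (toPair V) (toPair fun j => deriv (U j)) ∧
      ∀ k : Fin 2, OrthH γ U (toPair W) (Pi.single k (toPair U k)) := by
  set Φ := modulate α (phase γ U Ψ α) Ψ with hΦ
  have hf : ∀ j, FiniteEnergy γ U j (Φ j) := fun j =>
    ((hΨ j).comp_add_right hU hγ α).const_mul _
  have hV : ∀ j, FiniteEnergy γ U j (toPair (fun j x => (Φ j x).re - U j x) j) := fun j => by
    rw [show toPair (fun j x => (Φ j x).re - U j x) j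
      = fun x => ((Φ j x).re : ℂ) - (U j x : ℂ) from funext fun x => by simp [toPair]]
    exact ((hf j).re hU hγ).sub (hU.finiteEnergy hγ j) hU hγ
  have hW : ∀ j, FiniteEnergy γ U j (toPair (fun j x => (Φ j x).im) j) := fun j =>
    (hf j).im hU hγ
  refine ⟨fun j x => (Φ j x).re - U j x, fun j x => (Φ j x).im, fun j x => ?_, ⟨?_, ?_, ?_⟩,
    fun k => ⟨?_, ?_, ?_⟩⟩
  · apply Complex.ext <;> simp
  · exact memH_of_finiteEnergy hV
  · exact memH_of_finiteEnergy fun j => hU.finiteEnergy_deriv hγ j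
  · have hj : ∀ j, ∫ x, (deriv (toPair (fun j x => (Φ j x).re - U j x) j) x
        * conj (deriv (toPair (fun j => deriv (U j)) j) x) + (weight γ U j x : ℂ)
          * toPair (fun j x => (Φ j x).re - U j x) j x * conj (toPair (fun j => deriv (U j)) j x))
        = ((posFun γ U j (Ψ j) α
          - (pairing (kerY γ U j) (fun x => (U j x : ℂ)) 0).re : ℝ) : ℂ) := by
      intro j
      have hY := hU.isKernel_Y hγ j
      obtain ⟨K, hK⟩ := (hf j).exists_growth hU hγ
      obtain ⟨L, hL⟩ := ((hf j).re hU hγ).exists_growth hU hγ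
      obtain ⟨M, hM⟩ := (hU.finiteEnergy hγ j).exists_growth hU hγ
      refine ((hV j).inner_eq hU hγ (hU.hasDerivAt_deriv j) (hU.isKernel_accel hγ j)
        (hU.decay_weight_mul_deriv hγ j)).trans ?_
      change pairing (kerY γ U j) _ 0 = _
      rw [show toPair (fun j x => (Φ j x).re - U j x) j
        = fun x => ((Φ j x).re : ℂ) - (U j x : ℂ) from funext fun x => by simp [toPair]]
      -- Rotating both pairings by the chosen phase leaves `posFun` unchanged and makes the
      -- Z-pairing |z| > 0, so `along` reduces to the real part of the rotated Y-pairing.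
      rw [pairing_sub hY.decay hY.continuous ((hf j).re hU hγ).1.continuous hL
        (hU.finiteEnergy hγ j).1.continuous hM,
        pairing_re hY.decay hY.continuous (hf j).1.continuous hK, hΦ, pairing_modulate,
        pairing_real _ (U j), Complex.ofReal_re, ← Complex.ofReal_sub, posFun,
        ← along_mul (phase γ U Ψ α j).toCircle, phase, toCircle_neg_arg_mul,
        along_ofReal (norm_pos_iff.2 (h0 j))]
    simp only [innerH, hj]
    rw [← Complex.ofReal_sum, Finset.sum_sub_distrib, hpos, posConst, sub_self,
      Complex.ofReal_zero]
  · exact memH_of_finiteEnergy hW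
  · refine memH_of_finiteEnergy fun j => ?_
    by_cases h : j = k
    · subst h
      rw [Pi.single_eq_same]
      exact hU.finiteEnergy hγ j
    · rw [Pi.single_eq_of_ne h]
      exact FiniteEnergy.zero
  · rw [innerH, Finset.sum_eq_single k]
    · rw [Pi.single_eq_same]
      have hZ := hU.isKernel_Z hγ k
      obtain ⟨K, hK⟩ := (hf k).exists_growth hU hγ
      refine ((hW k).inner_eq hU hγ (hU.hasDerivAt k) (hU.isKernel_deriv hγ k)
        (hU.decay_weight_mul hγ k)).trans ?_
      change pairing (kerZ γ U k) (fun x => ((Φ k x).im : ℂ)) 0 = _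
      rw [pairing_im hZ.decay hZ.continuous (hf k).1.continuous hK, hΦ, pairing_modulate, phase,
        toCircle_neg_arg_mul, Complex.ofReal_im, Complex.ofReal_zero]
    · intro j _ h
      rw [Pi.single_eq_of_ne h]
      simp [Pi.zero_def]
    · simp

/-- The infimum need not be attained; the gap between ε/4 and ε/2 supplies an actual shift and
phases. -/
theorem tube_exists_near {ε : ℝ} (hε : 0 < ε) {Ψ : Pair} (h : Ψ ∈ tube γ U (ε / 4)) :
    ∃ a θ, Near γ U (ε / 2) Ψ a θ := by
  have h1 := h.2.2.trans_lt
    ((ENNReal.ofReal_lt_ofReal_iff (by positivity)).2 (show ε / 4 < ε / 2 by linarith))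
  simp only [iInf_lt_iff] at h1
  obtain ⟨a, θ₁, θ₂, h2⟩ := h1
  exact ⟨a, _, energy_le_of_normH_le h2.le⟩

/-- `α` solves the modulation equation near an approximate position of `Ψ`. -/
def IsPosition (γ : ℝ) (U : RealPair) (η s : ℝ) (Ψ : Pair) (α : ℝ) : Prop :=
  (∃ a θ, Near γ U η Ψ a θ ∧ |α - a| ≤ s) ∧ ∑ j, posFun γ U j (Ψ j) α = posConst γ U

/-- A nearby Φ may be observed in the frame (a, θ) of Ψ. Since the translation constant depends on
a, so does δ, which is enough for pointwise continuity. -/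
theorem IsDomainWall.exists_near_of_perturbation (hU : IsDomainWall γ U) (hγ : 1 < γ) {ε : ℝ}
    (hε : 0 < ε) {Ψ : Pair} (hΨ : ∀ j, H1loc (Ψ j)) {a : ℝ} {θ : Fin 2 → Real.Angle}
    (h : Near γ U (ε / 2) Ψ a θ) : ∃ δ, 0 < δ ∧ ∀ Φ : Pair, (∀ j, H1loc (Φ j)) →
      (∀ j, energy γ U j (fun x => Φ j x - Ψ j x) ≤ ENNReal.ofReal (δ ^ 2)) →
      Near γ U ε Φ a θ := by
  have hj : ∀ j, ∃ δ, 0 < δ ∧ ∀ Φ : Pair, (∀ j, H1loc (Φ j)) →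
      energy γ U j (fun x => Φ j x - Ψ j x) ≤ ENNReal.ofReal (δ ^ 2) →
      energy γ U j (fun x => ((θ j).toCircle : ℂ) * Φ j (x + a) - (U j x : ℂ))
        ≤ ENNReal.ofReal (ε ^ 2) := by
    intro j
    obtain ⟨K, hK, H⟩ := hU.exists_energy_translate_le hγ j a
    refine ⟨ε / (2 * (K + 1)), by positivity, fun Φ hΦ hN => ?_⟩
    have hd := (hΦ j).sub (hΨ j)
    have h1 := H _ hd _ (by positivity) hN
    rw [← energy_const_mul (θ j).toCircle] at h1
    have h2 := energy_add_le (hU.weight_nonneg hγ j) ((hΨ j).modulate_sub hU j (θ j).toCircle a)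
      ((hd.comp_add_right a).const_mul (θ j).toCircle) (hU.continuous_weight j)
    rw [show (fun x => ((θ j).toCircle : ℂ) * Ψ j (x + a) - (U j x : ℂ)
      + ((θ j).toCircle : ℂ) * (Φ j (x + a) - Ψ j (x + a)))
      = fun x => ((θ j).toCircle : ℂ) * Φ j (x + a) - (U j x : ℂ) from
        funext fun x => by ring] at h2
    refine h2.trans ((add_le_add (mul_le_mul_right (h j) 2) (mul_le_mul_right h1 2)).trans ?_)
    rw [← ENNReal.ofReal_ofNat 2, ← ENNReal.ofReal_mul (by norm_num),
      ← ENNReal.ofReal_mul (by norm_num), ← ENNReal.ofReal_add (by positivity) (by positivity)]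
    apply ENNReal.ofReal_le_ofReal
    have e : K * (ε / (2 * (K + 1))) ^ 2 ≤ ε ^ 2 / 4 := by
      rw [div_pow, mul_div_assoc', div_le_div_iff₀ (by positivity) (by norm_num)]
      have : 0 ≤ ε ^ 2 * (K ^ 2 + K + 1) := by positivity
      nlinarith
    nlinarith
  obtain ⟨δ₀, p₀, H₀⟩ := hj 0
  obtain ⟨δ₁, p₁, H₁⟩ := hj 1
  refine ⟨min δ₀ δ₁, by positivity, fun Φ hΦ hN j => ?_⟩
  have m : (0 : ℝ) ≤ min δ₀ δ₁ := by positivity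
  fin_cases j
  · exact H₀ Φ hΦ (energy_mono_sq (hN 0) m (min_le_left _ _))
  · exact H₁ Φ hΦ (energy_mono_sq (hN 1) m (min_le_right _ _))

end

end DomainWall

end

/-! ### The modulation theorem and continuity of the parameters -/

open DomainWall in
theorem mainTheorem5 (γ : ℝ) (hγ : 1 < γ) (U : DomainWall.RealPair)
    (hU : DomainWall.IsDomainWall γ U) :
    ∃ ε₀ : ℝ, 0 < ε₀ ∧
      ∃ (α : DomainWall.Pair → ℝ) (θ : DomainWall.Pair → Fin 2 → Real.Angle),
        (∀ Ψ ∈ DomainWall.tube γ U ε₀,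
          ∃ V W : DomainWall.RealPair,
            (∀ j x, DomainWall.modulate (α Ψ) (θ Ψ) Ψ j x
              = (U j x : ℂ) + (V j x : ℂ) + Complex.I * (W j x : ℂ)) ∧
            DomainWall.OrthH γ U (DomainWall.toPair V)
              (DomainWall.toPair fun j => deriv (U j)) ∧
            ∀ k : Fin 2, DomainWall.OrthH γ U (DomainWall.toPair W)
              (Pi.single k (DomainWall.toPair U k))) ∧
        (∀ Ψ ∈ DomainWall.tube γ U ε₀, ∀ η : ℝ, 0 < η →
          ∃ δ : ℝ, 0 < δ ∧ ∀ Φ ∈ DomainWall.tube γ U ε₀,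
            DomainWall.normH γ U (Φ - Ψ) < ENNReal.ofReal δ →
              dist (α Φ) (α Ψ) < η ∧ ∀ j, dist (θ Φ j) (θ Ψ j) < η) := by
  classical
  obtain ⟨s, hs, κ, hκ, ε₁, hε₁, loc⟩ := hU.exists_local hγ
  obtain ⟨ε₂, hε₂, rig⟩ := hU.abs_sub_lt_of_near hγ (show 0 < s / 4 by positivity)
  obtain ⟨ε, hε, l₁, l₂⟩ : ∃ ε, 0 < ε ∧ ε ≤ ε₁ ∧ ε ≤ ε₂ :=
    ⟨min ε₁ ε₂, by positivity, min_le_left _ _, min_le_right _ _⟩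
  have ex : ∀ Ψ ∈ tube γ U (ε / 4), ∃ α, IsPosition γ U (ε / 2) (s / 4) Ψ α := by
    intro Ψ hΨ
    obtain ⟨a, θ, h⟩ := tube_exists_near hε hΨ
    obtain ⟨-, -, b, hb, e⟩ := loc Ψ hΨ.1.h1loc a θ (h.mono (by positivity) (by linarith))
    exact ⟨b, ⟨a, θ, h, hb⟩, e⟩
  -- An arbitrary root is taken for each Ψ; continuity below does not depend on the selection.
  choose! α hα using ex
  refine ⟨ε / 4, by positivity, α, fun Ψ => phase γ U Ψ (α Ψ), fun Ψ hΨ => ?_,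
    fun Ψ hΨ η hη => ?_⟩
  · obtain ⟨⟨a, θ, h, hb⟩, e⟩ := hα Ψ hΨ
    have hN : Near γ U ε₁ Ψ a θ := h.mono (by positivity) (by linarith)
    exact hU.exists_decomposition hγ (hU.finiteEnergy_of_near hγ hΨ.1.h1loc h)
      ((loc Ψ hΨ.1.h1loc a θ hN).1 (α Ψ) (by linarith)) e
  obtain ⟨⟨a, θ, h, hb⟩, e⟩ := hα Ψ hΨ
  have hfe := hU.finiteEnergy_of_near hγ hΨ.1.h1loc h
  have hz := (loc Ψ hΨ.1.h1loc a θ (h.mono (by positivity) (by linarith))).1 (α Ψ) (by linarith)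
  obtain ⟨δ', hδ', near⟩ := hU.exists_near_of_perturbation hγ hε hΨ.1.h1loc h
  have ang : ∀ j, ∃ t, 0 < t ∧ ∀ φ, FiniteEnergy γ U j φ →
      energy γ U j (fun x => φ x - Ψ j x) ≤ ENNReal.ofReal (t ^ 2) → ∀ b, |b - α Ψ| ≤ t →
      dist (-(Complex.arg (pairing (kerZ γ U j) φ b) : Real.Angle)) (phase γ U Ψ (α Ψ) j)
        < η := by
    intro j
    -- As an angle modulo 2π, the argument is continuous at every nonzero point, with no branch cut.
    obtain ⟨d, hd, H⟩ := Metric.continuousAt_iff.1 (Complex.continuousAt_arg_coe_angle (hz j)) η hη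
    have hZ := hU.isKernel_Z hγ j
    obtain ⟨t, ht, H'⟩ := hU.pairing_near hγ hZ.decay hZ.continuous (hfe j) (α Ψ) hd
    refine ⟨t, ht, fun φ hφ hN b hb => ?_⟩
    rw [phase, dist_neg_neg]
    exact H (by rw [dist_eq_norm]; exact H' φ hφ hN b hb)
  obtain ⟨t₀, ht₀, A₀⟩ := ang 0
  obtain ⟨t₁, ht₁, A₁⟩ := ang 1
  obtain ⟨ρ, hρ, ρη, ρ₀, ρ₁⟩ : ∃ ρ, 0 < ρ ∧ ρ ≤ η ∧ ρ ≤ t₀ ∧ ρ ≤ t₁ :=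
    ⟨min η (min t₀ t₁), by positivity, by simp, by simp, by simp⟩
  obtain ⟨p₀, hp₀, P₀⟩ := hU.posFun_near hγ (hfe 0) (hz 0) (show 0 < κ * ρ / 2 by positivity)
  obtain ⟨p₁, hp₁, P₁⟩ := hU.posFun_near hγ (hfe 1) (hz 1) (show 0 < κ * ρ / 2 by positivity)
  obtain ⟨δ, hδ, m, m₀, m₁, n₀, n₁⟩ :
      ∃ δ, 0 < δ ∧ δ ≤ δ' ∧ δ ≤ t₀ ∧ δ ≤ t₁ ∧ δ ≤ p₀ ∧ δ ≤ p₁ :=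
    ⟨min δ' (min t₀ (min t₁ (min p₀ p₁))), by positivity, by simp, by simp, by simp, by simp,
      by simp⟩
  refine ⟨δ, hδ, fun Φ hΦ hN => ?_⟩
  have hE : ∀ j, energy γ U j (fun x => Φ j x - Ψ j x) ≤ ENNReal.ofReal (δ ^ 2) :=
    energy_le_of_normH_le hN.le
  obtain ⟨⟨b, θ', h', hb'⟩, e'⟩ := hα Φ hΦ
  have hfe' := hU.finiteEnergy_of_near hγ hΦ.1.h1loc h'
  have hnear := near Φ hΦ.1.h1loc fun j => energy_mono_sq (hE j) hδ.le m
  -- Rigidity links the frame inherited from Ψ to the frame (b, θ') that located α(Φ). Hence |α(Φ) -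
  -- a| ≤ s/4 + s/4, inside the window around a where the equation is monotone.
  have hab := rig Φ hΦ.1.h1loc a b θ θ' (hnear.mono hε.le l₂)
    (h'.mono (by positivity) (by linarith))
  have key := (loc Φ hΦ.1.h1loc a θ (hnear.mono hε.le l₁)).2.1 (α Ψ) (α Φ) (by linarith) (by
    have h1 := abs_lt.1 hab
    have h2 := abs_le.1 hb'
    rw [abs_le]
    constructor <;> linarith [h1.1, h1.2, h2.1, h2.2])
  have q₀ := abs_lt.1 (P₀ (Φ 0) (hfe' 0) (energy_mono_sq (hE 0) hδ.le n₀))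
  have q₁ := abs_lt.1 (P₁ (Φ 1) (hfe' 1) (energy_mono_sq (hE 1) hδ.le n₁))
  -- Both roots give the value `posConst`, so the first sum may be replaced by that of Ψ at α(Ψ).
  -- Only the dependence on the function, at the fixed shift α(Ψ), remains to be estimated.
  have hlt : |∑ j, posFun γ U j (Φ j) (α Φ) - ∑ j, posFun γ U j (Φ j) (α Ψ)| < κ * ρ := by
    rw [e', ← e, Fin.sum_univ_two, Fin.sum_univ_two, abs_lt]
    constructor <;> linarith [q₀.1, q₀.2, q₁.1, q₁.2]
  have hdist : |α Φ - α Ψ| < ρ := lt_of_mul_lt_mul_left (key.trans_lt hlt) hκ.le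
  refine ⟨by rw [Real.dist_eq]; linarith, fun j => ?_⟩
  fin_cases j
  · exact A₀ (Φ 0) (hfe' 0) (energy_mono_sq (hE 0) hδ.le m₀) _ (hdist.le.trans ρ₀)
  · exact A₁ (Φ 1) (hfe' 1) (energy_mono_sq (hE 1) hδ.le m₁) _ (hdist.le.trans ρ₁)
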